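/- **Setting.** Let $l\ge 1$, $t\ge 2$, $n,u\ge 0$. All qudit indices run from $1$. For an operator $\rho$ on $n$ qudits and $J\subseteq\{1,\dots,n\}$, the *deletion* $\mathcal D_J(\rho)$ is the partial trace of $\rho$ over the qudits in $J$. For a state $\rho$ of $n$ qudits, $\mathscr L^{(1)}(\rho)$ is the set of states obtained from $\rho$ by one insertion (a qudit in an arbitrary density matrix $\pi$, in product with $\rho$, is inserted at an arbitrary position) followed by one deletion at an arbitrary index. A *quantum channel* is a completely positive trace-preserving linear map. Let $\mathcal C_0$ be a code of $n$ qudits of level $l$, given by an isometry $V:(\mathbb C^l)^{\otimes u}\to(\mathbb C^l)^{\otimes n}$ (the codeword of the message $|\mu\rangle$, a unit vector, is $V|\mu\rangle$). Suppose $\mathcal C_0$ corrects $t$ erasures: for every $J$ with $|J|\le t$ there is a channel, which may depend on $J$, sending $\mathcal D_J(V|\mu\rangle\langle\mu|V^\dagger)$ to $|\mu\rangle\langle\mu|$ for every message $|\mu\rangle$. For $k\in\{0,\dots,t\}$ let $\eta_k:\mathbb C^l\to\mathbb C^{l(t+1)}$, $|j\rangle\mapsto|j(t+1)+k\rangle$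 $(0\le j\le l-1)$, and $M_k=\sum_{j=0}^{l-1}|j(t+1)+k\rangle\langle j(t+1)+k|$. Let $\boldsymbol m=(m_1,\dots,m_n)$ with $m_i=(i-1)\bmod(t+1)$. The Matsumoto–Hagiwara code $\mathcal C_{n,l,t}$ encodes $|\mu\rangle$ as $|\psi\rangle=(\eta_{m_1}\otimes\cdots\otimes\eta_{m_n})V|\mu\rangle$. A *single-unitary-error corrector* of $\mathcal C_0$ is a channel $\Phi$ with $\Phi(U_iV|\mu\rangle\langle\mu|V^\dagger U_i^\dagger)=|\mu\rangle\langle\mu|$ for all messages $|\mu\rangle$, all $i\in\{1,\dots,n\}$ and all unitary $l\times l$ matrices $U$, where $U_i$ is $U$ acting on the $i$th qudit. A *deletion corrector* of $\mathcal C_{n,l,t}$ is a family of channels $\Delta_m$ (one for each number $m$ of received qudits) with $\Delta_{n-|J|}(\mathcal D_J(|\psi\rangle\langle\psi|))=|\mu\rangle\langle\mu|$ for all $J$ with $|J|\le t$ and all messages $|\mu\rangle$ with codeword $|\psi\rangle$. **Decoding algorithm** (with correctors $\Phi$, $\Delta$). Input: a state $\rho$ of $n$ qudits of level $l(t+1)$.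 1. Measure each qudit of $\rho$ by $\{M_0,\dots,M_t\}$; let $\boldsymbol r=(r_1,\dots,r_n)$ be the results and $\sigma$ the state after the measurement. If $\boldsymbol r=\boldsymbol m$ go to 2, otherwise to 3. 2. Undo $\eta_{m_i}$ on the $i$th qudit of $\sigma$ for all $i$, apply $\Phi$ and output the result. 3. Put $h_{i,0}=i$, $h_{0,j}=j$ and $h_{i,j}=\min\{h_{i,j-1}+1,\ h_{i-1,j}+1,\ h_{i-1,j-1}+2\cdot\mathbf 1[m_i\ne r_j]\}$ for $1\le i,j\le n$. 4. Compute $S_1$: start with $(i,j)=(n,n)$, $S_1=\emptyset$, and while $i\ge1$ or $j\ge1$ carry out the first of the following that applies: (a) if $i\ge1$ and $h_{i,j}=h_{i-1,j}+1$, decrease $i$ by $1$; (b) if $i,j\ge1$ and $m_i=r_j$, decrease $i$ and $j$ by $1$; (c) if $j\ge1$ and $h_{i,j}=h_{i,j-1}+1$, put $j$ into $S_1$ and then decrease $j$ by $1$. Compute $S_2$ by the same loop with the order (c), (b), (a). 5. Form $\mathcal D_{S_1\cup S_2}(\sigma)$. 6. Apply $\Delta_{n-|S_1\cup S_2|}$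 and output the result. **Theorem.** Under these assumptions, $\mathcal C_0$ has a single-unitary-error corrector and $\mathcal C_{n,l,t}$ has a deletion corrector. Moreover, let $\Phi$ and $\Delta$ be any such correctors, let $|\mu\rangle$ be a message, $|\psi\rangle\in\mathcal C_{n,l,t}$ its codeword, and $\rho\in\mathscr L^{(1)}(|\psi\rangle\langle\psi|)$. Then for every sequence $\boldsymbol r$ of results that occurs with nonzero probability in step 1, the algorithm halts and its output is exactly $|\mu\rangle\langle\mu|$; and if $\boldsymbol r\ne\boldsymbol m$, then $|S_1\cup S_2|\le2$. -/

import Mathlib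

namespace IndelQuantum

open Finset Matrix
open scoped ComplexOrder

/-! ### Words and subwords -/

theorem card_compl_eq_sub {n : ℕ} (J : Finset (Fin n)) : #Jᶜ = n - #J := by
  rw [Finset.card_compl, Fintype.card_fin]

theorem card_compl_of_card {n t : ℕ} {J : Finset (Fin (n + t))} (h : #J = t) : #Jᶜ = n := by
  rw [card_compl_eq_sub, h, Nat.add_sub_cancel]

/-- For `K = {k₁ < ⋯ < kₘ}`, the subword `x_K = (x_{k₁}, …, x_{kₘ})` of `x`. -/
def subword {α : Type*} {n m : ℕ} (K : Finset (Fin n)) (h : #K = m) (x : Fin n → α) :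
    Fin m → α :=
  fun i => x (K.orderEmbOfFin h i)

/-! ### Quantum states -/

/-- Operators on `n` qudits of level `d`, written in the basis `|x⟩`, `x` a word of length `n`. -/
abbrev QOp (d n : ℕ) : Type := Matrix (Fin n → Fin d) (Fin n → Fin d) ℂ

/-- State vectors of `n` qudits of level `d` (unit length is a separate condition). -/
abbrev QVec (d n : ℕ) : Type := (Fin n → Fin d) → ℂ

/-- The density matrices: positive semidefinite with trace one. -/
def IsDensity {d n : ℕ} (ρ : QOp d n) : Prop := ρ.PosSemidef ∧ ρ.trace = 1

/-- The vector has norm one. -/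
def IsUnitKet {d n : ℕ} (ψ : QVec d n) : Prop := star ψ ⬝ᵥ ψ = 1

/-- The pure state `|ψ⟩⟨ψ|`. -/
def ketbra {d n : ℕ} (ψ : QVec d n) : QOp d n := vecMulVec ψ (star ψ)

/-- A quantum channel (completely positive trace-preserving map) in operator-sum form. -/
def IsChannel {A B : Type*} [Fintype A] [DecidableEq A] [Fintype B]
    (Φ : Matrix A A ℂ →ₗ[ℂ] Matrix B B ℂ) : Prop :=
  ∃ (k : ℕ) (K : Fin k → Matrix B A ℂ),
    (∑ a, (K a)ᴴ * K a = 1) ∧ ∀ ρ, Φ ρ = ∑ a, K a * ρ * (K a)ᴴ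

/-! ### Deletions, insertions and unitary errors -/

/-- Deletion of the qudits with indices in `J`: the partial trace over `J`,
`ρ = ∑ c_{x,y} |x⟩⟨y| ↦ ∑ c_{x,y} tr(|x_J⟩⟨y_J|) |x_{Jᶜ}⟩⟨y_{Jᶜ}|`. -/
def deletion {d n m : ℕ} (J : Finset (Fin n)) (h : #Jᶜ = m) (ρ : QOp d n) : QOp d m :=
  Matrix.of fun v w => ∑ x : Fin n → Fin d, ∑ y : Fin n → Fin d,
    if (∀ i ∈ J, x i = y i) ∧ subword Jᶜ h x = v ∧ subword Jᶜ h y = w then ρ x y else 0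

/-- Insertion: the product state `π ⊗ ρ` arranged so that the qudits of `π` occupy, in order, the
positions in `J`, and those of `ρ`, in order, the other positions. -/
def insertion {d n t : ℕ} (J : Finset (Fin (n + t))) (h : #J = t) (π : QOp d t) (ρ : QOp d n) :
    QOp d (n + t) :=
  Matrix.of fun x y => π (subword J h x) (subword J h y) *
    ρ (subword Jᶜ (card_compl_of_card h) x) (subword Jᶜ (card_compl_of_card h) y)

/-- The states obtained from `ρ` by `t` insertions followed by `t` deletions. -/
def indelSet {d n : ℕ} (t : ℕ) (ρ : QOp d n) : Set (QOp d n) :=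
  {ρ' | ∃ (J₁ J₂ : Finset (Fin (n + t))) (h₁ : #J₁ = t) (h₂ : #J₂ = t) (π : QOp d t),
    IsDensity π ∧ ρ' = deletion J₁ (card_compl_of_card h₁) (insertion J₂ h₂ π ρ)}

/-- The operator acting as `U` on the qudit with index `i` and as the identity on the others. -/
def localOp {d n : ℕ} (i : Fin n) (U : Matrix (Fin d) (Fin d) ℂ) : QOp d n :=
  Matrix.of fun x y => if ∀ k, k ≠ i → x k = y k then U (x i) (y i) else 0

/-! ### Codes and their correctors

A code with message space `(ℂ^l)^{⊗u}` is given by its encoder `V`; the codeword of the message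
`|μ⟩` is `V|μ⟩`. -/

/-- Linear encoders of `u` qudits of level `l` into `n` qudits of level `d`. -/
abbrev Encoder (l u d n : ℕ) : Type := Matrix (Fin n → Fin d) (Fin u → Fin l) ℂ

/-- The code corrects the erasure of at most `t` qudits: deletions at known indices `J`, so that the
recovery channel may depend on `J`. -/
def IsErasureCorrecting {l u n : ℕ} (t : ℕ) (V : Encoder l u l n) : Prop :=
  ∀ J : Finset (Fin n), #J ≤ t →
    ∃ R : QOp l (n - #J) →ₗ[ℂ] QOp l u, IsChannel R ∧
      ∀ μ : QVec l u, IsUnitKet μ →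
        R (deletion J (card_compl_eq_sub J) (ketbra (V *ᵥ μ))) = ketbra μ

/-- `Φ` is a single-unitary-error-correcting algorithm: one channel that returns the message,
whatever the error and its (unknown) position. -/
def IsUnitaryErrorCorrector {l u n : ℕ} (V : Encoder l u l n)
    (Φ : QOp l n →ₗ[ℂ] QOp l u) : Prop :=
  IsChannel Φ ∧
    ∀ (i : Fin n) (U : Matrix (Fin l) (Fin l) ℂ), U ∈ Matrix.unitaryGroup (Fin l) ℂ →
      ∀ μ : QVec l u, IsUnitKet μ →
        Φ (localOp i U * ketbra (V *ᵥ μ) * (localOp i U)ᴴ) = ketbra μ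

/-- `Δ` is an algorithm correcting at most `t` deletions at unknown indices: one channel `Δ m` for
each length `m` of the received state. -/
def IsDeletionCorrector {l u d n : ℕ} (t : ℕ) (W : Encoder l u d n)
    (Δ : (m : ℕ) → QOp d m →ₗ[ℂ] QOp l u) : Prop :=
  (∀ m, IsChannel (Δ m)) ∧
    ∀ J : Finset (Fin n), #J ≤ t → ∀ μ : QVec l u, IsUnitKet μ →
      Δ (n - #J) (deletion J (card_compl_eq_sub J) (ketbra (W *ᵥ μ))) = ketbra μ

/-! ### The deletion-correcting code built from an erasure-correcting code -/

/-- The map `η_k` on basis labels, `j ↦ j (t + 1) + k`. -/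
def eta {l t : ℕ} (k : Fin (t + 1)) (j : Fin l) : Fin (l * (t + 1)) := finProdFinEquiv (j, k)

/-- The monotonically increasing periodic sequence `0, 1, …, t, 0, 1, …, t, 0, …` of length `n`. -/
def periodicSeq (n t : ℕ) : Fin n → Fin (t + 1) := fun i => Fin.ofNat (t + 1) i.val

/-- The isometry `η_{r₁} ⊗ ⋯ ⊗ η_{rₙ}`. -/
def etaIso {n t : ℕ} (l : ℕ) (r : Fin n → Fin (t + 1)) :
    Matrix (Fin n → Fin (l * (t + 1))) (Fin n → Fin l) ℂ :=
  Matrix.of fun x z => if x = fun i => eta (r i) (z i) then 1 else 0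

/-- The encoder of the deletion-correcting code: encode by `V`, then apply `η_{(i-1) % (t+1)}` to
the `i`th qudit for all `i`. -/
def delEncoder {l u n : ℕ} (t : ℕ) (V : Encoder l u l n) : Encoder l u (l * (t + 1)) n :=
  etaIso l (periodicSeq n t) * V

/-- The projection `M_k = ∑_j |j(t+1)+k⟩⟨j(t+1)+k|` of the single-qudit measurement. -/
def measProj {t : ℕ} (l : ℕ) (k : Fin (t + 1)) :
    Matrix (Fin (l * (t + 1))) (Fin (l * (t + 1))) ℂ :=
  ∑ j : Fin l, vecMulVec (Pi.single (eta k j) (1 : ℂ)) (star (Pi.single (eta k j) (1 : ℂ)))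

/-- The projection `M_{r₁} ⊗ ⋯ ⊗ M_{rₙ}` for the sequence `r` of results, all qudits being
measured. -/
def measProjSeq {n t : ℕ} (l : ℕ) (r : Fin n → Fin (t + 1)) : QOp (l * (t + 1)) n :=
  Matrix.of fun x y => ∏ i, measProj l (r i) (x i) (y i)

/-- The probability of the results `r`. -/
noncomputable def resultProb {l n t : ℕ} (r : Fin n → Fin (t + 1)) (ρ : QOp (l * (t + 1)) n) : ℂ :=
  (measProjSeq l r * ρ).trace

/-- The state after the measurement with results `r`. -/
noncomputable def postState {l n t : ℕ} (r : Fin n → Fin (t + 1)) (ρ : QOp (l * (t + 1)) n) :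
    QOp (l * (t + 1)) n :=
  (resultProb r ρ)⁻¹ • (measProjSeq l r * ρ * (measProjSeq l r)ᴴ)

/-! ### Indel table and backtracking -/

/-- With symbols numbered from `1`: `1 ≤ i ≤ n`, `1 ≤ j ≤ m` and `x_i = y_j`. -/
def SymEq {α : Type*} {n m : ℕ} (x : Fin n → α) (y : Fin m → α) (i j : ℕ) : Prop :=
  ∃ (a : Fin n) (b : Fin m), a.val + 1 = i ∧ b.val + 1 = j ∧ x a = y b

instance {α : Type*} [DecidableEq α] {n m : ℕ} (x : Fin n → α) (y : Fin m → α) (i j : ℕ) :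
    Decidable (SymEq x y i j) := by
  unfold SymEq; infer_instance

/-- The entries `h_{i,j}` of the dynamic-programming table for the indel distance. -/
def indelTable {α : Type*} [DecidableEq α] {n m : ℕ} (x : Fin n → α) (y : Fin m → α) :
    ℕ → ℕ → ℕ
  | i, 0 => i
  | 0, j + 1 => j + 1
  | i + 1, j + 1 =>
    min (min (indelTable x y (i + 1) j + 1) (indelTable x y i (j + 1) + 1))
      (indelTable x y i j + if SymEq x y (i + 1) (j + 1) then 0 else 2)
  termination_by i j => i + j

/-- The loop of the first backtracking subroutine, from `(i, j)` on, for the table `h`. The value is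
the set of indices collected, or `none` if the loop never ends (no branch applies). -/
def backtrackUp {α : Type*} [DecidableEq α] {n m : ℕ} (x : Fin n → α) (y : Fin m → α)
    (h : ℕ → ℕ → ℕ) (i j : ℕ) : Option (Finset ℕ) :=
  if i = 0 ∧ j = 0 then some ∅
  else if 1 ≤ i ∧ h i j = h (i - 1) j + 1 then backtrackUp x y h (i - 1) j
  else if 1 ≤ i ∧ 1 ≤ j ∧ SymEq x y i j then backtrackUp x y h (i - 1) (j - 1)
  else if 1 ≤ j ∧ h i j = h i (j - 1) + 1 then (backtrackUp x y h i (j - 1)).map (insert j)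
  else none
  termination_by i + j

/-- The loop of the second subroutine: the first and the last branch change places. -/
def backtrackLeft {α : Type*} [DecidableEq α] {n m : ℕ} (x : Fin n → α) (y : Fin m → α)
    (h : ℕ → ℕ → ℕ) (i j : ℕ) : Option (Finset ℕ) :=
  if i = 0 ∧ j = 0 then some ∅
  else if 1 ≤ j ∧ h i j = h i (j - 1) + 1 then (backtrackLeft x y h i (j - 1)).map (insert j)
  else if 1 ≤ i ∧ 1 ≤ j ∧ SymEq x y i j then backtrackLeft x y h (i - 1) (j - 1)
  else if 1 ≤ i ∧ h i j = h (i - 1) j + 1 then backtrackLeft x y h (i - 1) j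
  else none
  termination_by i + j

/-- Output of the first subroutine on `x`, `y` and their indel table (indices from `1`). -/
def subroutineOne {α : Type*} [DecidableEq α] {n m : ℕ} (x : Fin n → α) (y : Fin m → α) :
    Option (Finset ℕ) :=
  backtrackUp x y (indelTable x y) n m

/-- Output of the second subroutine on `x`, `y` and their indel table (indices from `1`). -/
def subroutineTwo {α : Type*} [DecidableEq α] {n m : ℕ} (x : Fin n → α) (y : Fin m → α) :
    Option (Finset ℕ) :=
  backtrackLeft x y (indelTable x y) n m

/-- The index set `S ⊆ {1, …, n}` as a subset of `Fin n`, whose elements count from `0`. -/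
def toIndexSet (n : ℕ) (S : Finset ℕ) : Finset (Fin n) :=
  Finset.univ.filter fun a => a.val + 1 ∈ S

/-! ### The decoding algorithm -/

/-- The decoder on the received state `ρ`, in the run in which the measurement gives `r`, with the
correctors `Φ` and `Δ`; `none` if it does not halt. If `r` is the periodic sequence, the measured
state is read on qudits of level `l` by undoing the maps `η` and handed to `Φ`; otherwise the
qudits at the candidate indices are deleted and the rest is handed to `Δ`. -/
noncomputable def decoder {l u n t : ℕ} (Φ : QOp l n →ₗ[ℂ] QOp l u)
    (Δ : (m : ℕ) → QOp (l * (t + 1)) m →ₗ[ℂ] QOp l u)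
    (ρ : QOp (l * (t + 1)) n) (r : Fin n → Fin (t + 1)) : Option (QOp l u) :=
  if r = periodicSeq n t then
    some (Φ ((etaIso l (periodicSeq n t))ᴴ * postState r ρ * etaIso l (periodicSeq n t)))
  else
    (subroutineOne (periodicSeq n t) r).bind fun S₁ =>
      (subroutineTwo (periodicSeq n t) r).bind fun S₂ =>
        some (Δ (n - #(toIndexSet n (S₁ ∪ S₂)))
          (deletion (toIndexSet n (S₁ ∪ S₂)) (card_compl_eq_sub _) (postState r ρ)))

end IndelQuantum

/-! Unless the insertion and the deletion cancel, `ρ` is the codeword with some qudit `b` deleted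
and a qudit of trace one inserted at some position `a` (`eq_or_exists_of_mem_indelSet_one`). The
surviving qudits lie in fixed ranges of the maps `η`, so the measurement leaves them alone and only
projects the inserted qudit (`postState_insertQudit`). Hence `r` is the periodic word `m` with the
symbol at `b` deleted and one symbol inserted at `a`.

If `r = m`, then `a = b`, because adjacent symbols of `m` differ; undoing `η` gives a codeword of
`V` with one qudit replaced. Each Kraus operator of `Φ` is a scalar on `U_a V` for unitary `U`. This
property is linear in `U` and unitaries span all matrices, so `Φ` also undoes the replacement
(`IsUnitaryErrorCorrector.apply_insertQudit`).

If `r ≠ m`, each subroutine collects one index, and one of the two is `a`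
(`subroutines_of_comp_succAbove`). Deleting both removes the inserted qudit and leaves the codeword
with at most `2 ≤ t` deletions, which `Δ` corrects. The combinatorics rests on a band around the
diagonal of the table: a diagonal entry is `0` exactly when the prefixes agree, and the entries
beside it are `1` when the prefixes differ by one deletion. The cases `a < b`, `a = b`, `a > b` are
settled by following the loops, using that three consecutive symbols of `m` are distinct.

`Φ` exists by the Knill–Laflamme conditions: two single-qudit errors touch at most two qudits, so an
erasure decoder for these qudits makes the products scalar. `Δ` exists because the `k`th surviving
qudit came from a window of `t + 1` consecutive positions, so its symbol in `m` locates it; this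
reduces deletions to erasures. -/

namespace IndelQuantum

open Finset Matrix
open scoped ComplexOrder

/-! ### Entries of the indel table near the diagonal, and the two loops there. -/

section Table

variable {α : Type*} [DecidableEq α] {n m : ℕ} (x : Fin n → α) (y : Fin m → α)

theorem indelTable_zero_right (i : ℕ) : indelTable x y i 0 = i := by
  unfold indelTable; rfl

theorem indelTable_zero_left (j : ℕ) : indelTable x y 0 j = j := by
  cases j <;> unfold indelTable <;> rfl

theorem indelTable_succ_succ (i j : ℕ) : indelTable x y (i + 1) (j + 1) =
    min (min (indelTable x y (i + 1) j + 1) (indelTable x y i (j + 1) + 1))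
      (indelTable x y i j + if SymEq x y (i + 1) (j + 1) then 0 else 2) := by
  conv_lhs => unfold indelTable

/-- Every branch of the recursion preserves this parity. It excludes the value `1` on the diagonal.
-/
theorem indelTable_parity (i j : ℕ) : (indelTable x y i j + i + j) % 2 = 0 := by
  induction i generalizing j with
  | zero => rw [indelTable_zero_left]; omega
  | succ i ih =>
    induction j with
    | zero => rw [indelTable_zero_right]; omega
    | succ j ihj =>
      have h₁ := ih j
      have h₂ := ih (j + 1)
      rw [indelTable_succ_succ]
      split_ifs <;> omega

/-- An indel distance is at least the difference of lengths. This is what discards recursion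
branches and loop branches that would leave the band around the diagonal. -/
theorem le_indelTable (i j : ℕ) :
    i ≤ indelTable x y i j + j ∧ j ≤ indelTable x y i j + i := by
  induction i generalizing j with
  | zero => rw [indelTable_zero_left]; omega
  | succ i ih =>
    induction j with
    | zero => rw [indelTable_zero_right]; omega
    | succ j ihj =>
      have h₁ := ih j
      have h₂ := ih (j + 1)
      rw [indelTable_succ_succ]
      split_ifs <;> omega

theorem indelTable_succ_left_le (i j : ℕ) :
    indelTable x y (i + 1) j ≤ indelTable x y i j + 1 := by
  cases j with
  | zero => simp only [indelTable_zero_right]; omega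
  | succ j => rw [indelTable_succ_succ]; omega

theorem indelTable_succ_right_le (i j : ℕ) :
    indelTable x y i (j + 1) ≤ indelTable x y i j + 1 := by
  cases i with
  | zero => simp only [indelTable_zero_left]; omega
  | succ i => rw [indelTable_succ_succ]; omega

theorem indelTable_diag_succ_eq_zero (i : ℕ) : indelTable x y (i + 1) (i + 1) = 0 ↔
    indelTable x y i i = 0 ∧ SymEq x y (i + 1) (i + 1) := by
  have h₃ := indelTable_succ_succ x y i i
  by_cases h : SymEq x y (i + 1) (i + 1)
  · rw [if_pos h] at h₃
    have h₁ := le_indelTable x y i (i + 1)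
    have h₂ := le_indelTable x y (i + 1) i
    simp only [h, and_true]
    constructor <;> intro h₄ <;> omega
  · rw [if_neg h] at h₃
    simp only [h, and_false, iff_false]
    omega

theorem indelTable_diag_eq_zero_of_le {i k : ℕ} (hik : i ≤ k) (h : indelTable x y k k = 0) :
    indelTable x y i i = 0 := by
  induction k, hik using Nat.le_induction with
  | base => exact h
  | succ k _ ih => exact ih ((indelTable_diag_succ_eq_zero x y k).1 h).1

/-- The entry at `(i, i + 2)` is at least `2`, so the value `1` can only come from the diagonal
entry on the left or from a match further up the superdiagonal. -/
theorem indelTable_upper_eq_one (i : ℕ) : indelTable x y (i + 1) (i + 2) = 1 ↔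
    indelTable x y (i + 1) (i + 1) = 0 ∨
      SymEq x y (i + 1) (i + 2) ∧ indelTable x y i (i + 1) = 1 := by
  have h₁ := le_indelTable x y i (i + 2)
  have h₂ := le_indelTable x y i (i + 1)
  have h₃ := indelTable_succ_succ x y i (i + 1)
  rw [add_assoc i 1 1, one_add_one_eq_two] at h₃
  by_cases h : SymEq x y (i + 1) (i + 2)
  · rw [if_pos h] at h₃
    simp only [h, true_and]
    constructor <;> intro h₄ <;> omega
  · rw [if_neg h] at h₃
    simp only [h, false_and, or_false]
    constructor <;> intro h₄ <;> omega

theorem indelTable_lower_eq_one (i : ℕ) : indelTable x y (i + 2) (i + 1) = 1 ↔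
    indelTable x y (i + 1) (i + 1) = 0 ∨
      SymEq x y (i + 2) (i + 1) ∧ indelTable x y (i + 1) i = 1 := by
  have h₁ := le_indelTable x y (i + 2) i
  have h₂ := le_indelTable x y (i + 1) i
  have h₃ := indelTable_succ_succ x y (i + 1) i
  rw [add_assoc i 1 1, one_add_one_eq_two] at h₃
  by_cases h : SymEq x y (i + 2) (i + 1)
  · rw [if_pos h] at h₃
    simp only [h, true_and]
    constructor <;> intro h₄ <;> omega
  · rw [if_neg h] at h₃
    simp only [h, false_and, or_false]
    constructor <;> intro h₄ <;> omega

theorem indelTable_upper_of_diag {i : ℕ} (h : indelTable x y i i = 0) :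
    indelTable x y i (i + 1) = 1 := by
  have h₁ := indelTable_succ_right_le x y i i
  have h₂ := le_indelTable x y i (i + 1)
  omega

theorem indelTable_lower_of_diag {i : ℕ} (h : indelTable x y i i = 0) :
    indelTable x y (i + 1) i = 1 := by
  have h₁ := indelTable_succ_left_le x y i i
  have h₂ := le_indelTable x y (i + 1) i
  omega

theorem indelTable_upper_pred {i : ℕ} (h : indelTable x y (i + 1) (i + 2) = 1) :
    indelTable x y i (i + 1) = 1 := by
  rcases (indelTable_upper_eq_one x y i).1 h with h | h
  · exact indelTable_upper_of_diag x y ((indelTable_diag_succ_eq_zero x y i).1 h).1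
  · exact h.2

/-- The step equation of the first backtracking loop. -/
theorem backtrackUp_eq (h : ℕ → ℕ → ℕ) (i j : ℕ) : backtrackUp x y h i j =
    if i = 0 ∧ j = 0 then some ∅
    else if 1 ≤ i ∧ h i j = h (i - 1) j + 1 then backtrackUp x y h (i - 1) j
    else if 1 ≤ i ∧ 1 ≤ j ∧ SymEq x y i j then backtrackUp x y h (i - 1) (j - 1)
    else if 1 ≤ j ∧ h i j = h i (j - 1) + 1 then (backtrackUp x y h i (j - 1)).map (insert j)
    else none := by
  conv_lhs => unfold backtrackUp

theorem backtrackLeft_eq (h : ℕ → ℕ → ℕ) (i j : ℕ) : backtrackLeft x y h i j =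
    if i = 0 ∧ j = 0 then some ∅
    else if 1 ≤ j ∧ h i j = h i (j - 1) + 1 then (backtrackLeft x y h i (j - 1)).map (insert j)
    else if 1 ≤ i ∧ 1 ≤ j ∧ SymEq x y i j then backtrackLeft x y h (i - 1) (j - 1)
    else if 1 ≤ i ∧ h i j = h (i - 1) j + 1 then backtrackLeft x y h (i - 1) j
    else none := by
  conv_lhs => unfold backtrackLeft

theorem backtrackUp_diag {i : ℕ} (h : indelTable x y i i = 0) :
    backtrackUp x y (indelTable x y) i i = some ∅ := by
  induction i with
  | zero => rw [backtrackUp_eq]; simp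
  | succ i ih =>
    have h' := (indelTable_diag_succ_eq_zero x y i).1 h
    rw [backtrackUp_eq, if_neg (by omega), if_neg (by omega),
      if_pos ⟨by omega, by omega, h'.2⟩]
    exact ih h'.1

theorem backtrackLeft_diag {i : ℕ} (h : indelTable x y i i = 0) :
    backtrackLeft x y (indelTable x y) i i = some ∅ := by
  induction i with
  | zero => rw [backtrackLeft_eq]; simp
  | succ i ih =>
    have h' := (indelTable_diag_succ_eq_zero x y i).1 h
    rw [backtrackLeft_eq, if_neg (by omega), if_neg (by omega),
      if_pos ⟨by omega, by omega, h'.2⟩]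
    exact ih h'.1

theorem backtrackUp_upper_zero : backtrackUp x y (indelTable x y) 0 1 = some {1} := by
  rw [backtrackUp_eq, if_neg (by omega), if_neg (by omega), if_neg (by omega),
    if_pos ⟨le_rfl, by simp [indelTable_zero_left]⟩]
  change Option.map _ (backtrackUp x y (indelTable x y) 0 0) = _
  rw [backtrackUp_diag x y (indelTable_zero_left x y 0)]; rfl

theorem backtrackLeft_upper_of_diag {i : ℕ} (h : indelTable x y i i = 0) :
    backtrackLeft x y (indelTable x y) i (i + 1) = some {i + 1} := by
  have h₁ := indelTable_upper_of_diag x y h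
  rw [backtrackLeft_eq, if_neg (by omega), if_pos ⟨by omega, by simp [h, h₁]⟩]
  change Option.map _ (backtrackLeft x y (indelTable x y) i i) = _
  rw [backtrackLeft_diag x y h]; rfl

theorem backtrackUp_upper_of_symEq {i : ℕ} (h : indelTable x y (i + 1) (i + 2) = 1)
    (hs : SymEq x y (i + 1) (i + 2)) :
    backtrackUp x y (indelTable x y) (i + 1) (i + 2) =
      backtrackUp x y (indelTable x y) i (i + 1) := by
  have h₁ := le_indelTable x y i (i + 2)
  rw [backtrackUp_eq, if_neg (by omega), if_neg (by simp only [Nat.add_sub_cancel]; omega),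
    if_pos ⟨by omega, by omega, hs⟩]
  rfl

theorem backtrackUp_upper_of_not_symEq {i : ℕ} (h : indelTable x y (i + 1) (i + 2) = 1)
    (hs : ¬ SymEq x y (i + 1) (i + 2)) :
    backtrackUp x y (indelTable x y) (i + 1) (i + 2) = some {i + 2} := by
  have h₁ := le_indelTable x y i (i + 2)
  have h₂ : indelTable x y (i + 1) (i + 1) = 0 := by
    rcases (indelTable_upper_eq_one x y i).1 h with h | h
    · exact h
    · exact absurd h.1 hs
  rw [backtrackUp_eq, if_neg (by omega), if_neg (by simp only [Nat.add_sub_cancel]; omega),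
    if_neg (by tauto), if_pos ⟨by omega, by simp [h, h₂]⟩]
  change Option.map _ (backtrackUp x y (indelTable x y) (i + 1) (i + 1)) = _
  rw [backtrackUp_diag x y h₂]; rfl

theorem backtrackLeft_upper_of_ne_zero {i : ℕ} (h : indelTable x y (i + 1) (i + 2) = 1)
    (h₂ : indelTable x y (i + 1) (i + 1) ≠ 0) :
    backtrackLeft x y (indelTable x y) (i + 1) (i + 2) =
      backtrackLeft x y (indelTable x y) i (i + 1) := by
  have hs : SymEq x y (i + 1) (i + 2) := by
    rcases (indelTable_upper_eq_one x y i).1 h with h | h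
    · exact absurd h h₂
    · exact h.1
  rw [backtrackLeft_eq, if_neg (by omega),
    if_neg (by change ¬ (_ ∧ _ = indelTable x y (i + 1) (i + 1) + 1); omega),
    if_pos ⟨by omega, by omega, hs⟩]
  rfl

/-- The first loop, started above the diagonal at distance one, collects exactly one index. -/
theorem exists_backtrackUp_upper {i : ℕ} (h : indelTable x y i (i + 1) = 1) :
    ∃ p, backtrackUp x y (indelTable x y) i (i + 1) = some {p} := by
  induction i with
  | zero => exact ⟨1, backtrackUp_upper_zero x y⟩
  | succ i ih =>
    by_cases hs : SymEq x y (i + 1) (i + 2)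
    · rw [backtrackUp_upper_of_symEq x y h hs]
      exact ih (indelTable_upper_pred x y h)
    · exact ⟨_, backtrackUp_upper_of_not_symEq x y h hs⟩

/-- The first loop collects the last index at which the shifted words disagree. -/
theorem backtrackUp_upper_eq {i p : ℕ} (hp : p ≤ i) (h : indelTable x y i (i + 1) = 1)
    (hm : ∀ k, p < k → k ≤ i → SymEq x y k (k + 1)) (hne : ¬ SymEq x y p (p + 1)) :
    backtrackUp x y (indelTable x y) i (i + 1) = some {p + 1} := by
  induction i, hp using Nat.le_induction with
  | base =>
    cases p with
    -- For `p = 0` the non-match holds automatically, symbols being numbered from `1`; in row `0`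
    -- only the leftward move remains.
    | zero => exact backtrackUp_upper_zero x y
    | succ p => exact backtrackUp_upper_of_not_symEq x y h hne
  | succ i hpi ih =>
    have hs := hm (i + 1) (by omega) le_rfl
    rw [backtrackUp_upper_of_symEq x y h hs]
    exact ih (indelTable_upper_pred x y h) fun k hk hk' => hm k hk (by omega)

/-- The second loop collects the first index at which the words disagree. -/
theorem backtrackLeft_upper_eq {i p : ℕ} (hp : p ≤ i) (h : indelTable x y i (i + 1) = 1)
    (h₀ : indelTable x y p p = 0) (hne : indelTable x y (p + 1) (p + 1) ≠ 0) :
    backtrackLeft x y (indelTable x y) i (i + 1) = some {p + 1} := by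
  induction i, hp using Nat.le_induction with
  | base => exact backtrackLeft_upper_of_diag x y h₀
  | succ i hpi ih =>
    -- The second loop leaves the superdiagonal as soon as the diagonal entry on its left is `0`,
    -- and zeros on the diagonal form an initial segment.
    have h₂ : indelTable x y (i + 1) (i + 1) ≠ 0 := fun h₂ =>
      hne (indelTable_diag_eq_zero_of_le x y (by omega) h₂)
    rw [backtrackLeft_upper_of_ne_zero x y h h₂]
    rcases (indelTable_upper_eq_one x y i).1 h with h | h
    · exact absurd h h₂
    · exact ih h.2

/-- At distance one below the diagonal, the prefix of `y` is the prefix of `x` with one symbol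
deleted. The path consists of matches and one upward move, so no index is collected. -/
theorem backtrackUp_lower {i : ℕ} (h : indelTable x y (i + 1) i = 1) :
    backtrackUp x y (indelTable x y) (i + 1) i = some ∅ := by
  by_cases h₂ : indelTable x y i i = 0
  · rw [backtrackUp_eq, if_neg (by omega), if_pos ⟨by omega, by simp [h, h₂]⟩]
    exact backtrackUp_diag x y h₂
  · induction i with
    | zero => exact absurd (indelTable_zero_left x y 0) h₂
    | succ i ih =>
      obtain ⟨hs, h₃⟩ := ((indelTable_lower_eq_one x y i).1 h).resolve_left h₂
      rw [backtrackUp_eq, if_neg (by omega), if_neg (by simp only [Nat.add_sub_cancel]; omega),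
        if_pos ⟨by omega, by omega, hs⟩]
      simp only [Nat.add_sub_cancel]
      by_cases h₄ : indelTable x y i i = 0
      · rw [backtrackUp_eq, if_neg (by omega), if_pos ⟨by omega, by simp [h₃, h₄]⟩]
        exact backtrackUp_diag x y h₄
      · exact ih h₃ h₄

theorem backtrackLeft_lower {i : ℕ} (h : indelTable x y (i + 1) i = 1) :
    backtrackLeft x y (indelTable x y) (i + 1) i = some ∅ := by
  induction i with
  | zero =>
    have h₂ := indelTable_zero_left x y 0
    rw [backtrackLeft_eq, if_neg (by omega), if_neg (by omega), if_neg (by omega),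
      if_pos ⟨by omega, by simp [h, h₂]⟩]
    exact backtrackLeft_diag x y h₂
  | succ i ih =>
    have h₁ := le_indelTable x y (i + 2) i
    change indelTable x y (i + 2) (i + 1) = 1 at h
    rw [backtrackLeft_eq, if_neg (by omega),
      if_neg (by change ¬ (_ ∧ indelTable x y (i + 2) (i + 1) = indelTable x y (i + 2) i + 1); omega)]
    by_cases hs : SymEq x y (i + 2) (i + 1)
    · rw [if_pos ⟨by omega, by omega, hs⟩]
      refine ih ?_
      rcases (indelTable_lower_eq_one x y i).1 h with h | h
      · exact indelTable_lower_of_diag x y ((indelTable_diag_succ_eq_zero x y i).1 h).1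
      · exact h.2
    · have h₂ : indelTable x y (i + 1) (i + 1) = 0 := by
        rcases (indelTable_lower_eq_one x y i).1 h with h | h
        · exact h
        · exact absurd h.1 hs
      rw [if_neg (by tauto), if_pos ⟨by omega, by simp [h, h₂]⟩]
      exact backtrackLeft_diag x y h₂

/-- On the diagonal, both loops pass over a match unless the neighbouring entry is small. -/
theorem backtrackUp_diag_of_symEq {i : ℕ} (hs : SymEq x y (i + 1) (i + 1))
    (h : indelTable x y (i + 1) (i + 1) ≠ indelTable x y i (i + 1) + 1) :
    backtrackUp x y (indelTable x y) (i + 1) (i + 1) =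
      backtrackUp x y (indelTable x y) i i := by
  rw [backtrackUp_eq, if_neg (by omega), if_neg (fun hc => h hc.2),
    if_pos ⟨by omega, by omega, hs⟩]
  rfl

theorem backtrackLeft_diag_of_symEq {i : ℕ} (hs : SymEq x y (i + 1) (i + 1))
    (h : indelTable x y (i + 1) (i + 1) ≠ indelTable x y (i + 1) i + 1) :
    backtrackLeft x y (indelTable x y) (i + 1) (i + 1) =
      backtrackLeft x y (indelTable x y) i i := by
  rw [backtrackLeft_eq, if_neg (by omega), if_neg (fun hc => h hc.2),
    if_pos ⟨by omega, by omega, hs⟩]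
  rfl

theorem backtrackUp_diag_of_upper {i : ℕ} (h : indelTable x y (i + 1) (i + 1) = 2)
    (h₁ : indelTable x y i (i + 1) = 1) :
    backtrackUp x y (indelTable x y) (i + 1) (i + 1) =
      backtrackUp x y (indelTable x y) i (i + 1) := by
  rw [backtrackUp_eq, if_neg (by omega), if_pos ⟨by omega, by simp [h, h₁]⟩]
  rfl

theorem backtrackLeft_diag_of_upper {i : ℕ} (h : indelTable x y (i + 1) (i + 1) = 2)
    (h₁ : indelTable x y i (i + 1) = 1) (h₂ : indelTable x y (i + 1) i ≠ 1)
    (hs : ¬ SymEq x y (i + 1) (i + 1)) :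
    backtrackLeft x y (indelTable x y) (i + 1) (i + 1) =
      backtrackLeft x y (indelTable x y) i (i + 1) := by
  rw [backtrackLeft_eq, if_neg (by omega), if_neg (by simp only [Nat.add_sub_cancel]; omega),
    if_neg (by tauto), if_pos ⟨by omega, by simp [h, h₁]⟩]
  rfl

theorem backtrackLeft_diag_of_lower {i : ℕ} (h : indelTable x y (i + 1) (i + 1) = 2)
    (h₁ : indelTable x y (i + 1) i = 1) :
    backtrackLeft x y (indelTable x y) (i + 1) (i + 1) = some {i + 1} := by
  rw [backtrackLeft_eq, if_neg (by omega), if_pos ⟨by omega, by simp [h, h₁]⟩]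
  change Option.map _ (backtrackLeft x y (indelTable x y) (i + 1) i) = _
  rw [backtrackLeft_lower x y h₁]; rfl

theorem backtrackUp_diag_of_lower {i : ℕ} (h : indelTable x y (i + 1) (i + 1) = 2)
    (h₁ : indelTable x y (i + 1) i = 1) (h₂ : indelTable x y i (i + 1) ≠ 1)
    (hs : ¬ SymEq x y (i + 1) (i + 1)) :
    backtrackUp x y (indelTable x y) (i + 1) (i + 1) = some {i + 1} := by
  rw [backtrackUp_eq, if_neg (by omega), if_neg (by simp only [Nat.add_sub_cancel]; omega),
    if_neg (by tauto), if_pos ⟨by omega, by simp [h, h₁]⟩]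
  change Option.map _ (backtrackUp x y (indelTable x y) (i + 1) i) = _
  rw [backtrackUp_lower x y h₁]; rfl

end Table

/-! ### The two loops on a word with one symbol deleted and one inserted. -/

section Backtracking

variable {α β : Type*} [DecidableEq α] {n : ℕ} {x y : Fin n → α} {M R : ℕ → β}

theorem indelTable_diag_le {m : ℕ} {y : Fin m → α} {k : ℕ} (hs : SymEq x y (k + 1) (k + 1)) :
    indelTable x y (k + 1) (k + 1) ≤ indelTable x y k k := by
  rw [indelTable_succ_succ, if_pos hs]; omega

theorem indelTable_diag_eq_two {k : ℕ} (h₀ : indelTable x y k k ≠ 0)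
    (h₂ : indelTable x y k k ≤ 2) : indelTable x y k k = 2 := by
  have := indelTable_parity x y k k
  omega

/-- `M` and `R` stand for the words `x` and `y` numbered from `1` and extended to `ℕ`. The extension
allows comparisons with `M (k + 1)` and `M (k + 2)` past the end of the word. -/
theorem indelTable_diag_eq_zero_iff
    (hs : ∀ i j, 1 ≤ i → i ≤ n → 1 ≤ j → j ≤ n → (SymEq x y i j ↔ M i = R j)) {k : ℕ}
    (hk : k ≤ n) : indelTable x y k k = 0 ↔ ∀ i, 1 ≤ i → i ≤ k → M i = R i := by
  induction k with
  | zero => simp only [indelTable_zero_left, true_iff]; omega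
  | succ k ih =>
    rw [indelTable_diag_succ_eq_zero, ih (by omega), hs _ _ (by omega) hk (by omega) hk]
    constructor
    · rintro ⟨h, h'⟩ i hi hik
      rcases Nat.lt_or_ge k i with hc | hc
      · obtain rfl : i = k + 1 := by omega
        exact h'
      · exact h i hi hc
    · exact fun h => ⟨fun i hi hik => h i hi (by omega), h _ (by omega) le_rfl⟩

theorem indelTable_diag_eq_two_of_le
    (hs : ∀ i j, 1 ≤ i → i ≤ n → 1 ≤ j → j ≤ n → (SymEq x y i j ↔ M i = R j))
    {c : ℕ} (h₀ : indelTable x y c c = 2) (hR : ∀ k, c < k → k ≤ n → R k = M k)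
    {k : ℕ} (hck : c ≤ k) (hkn : k ≤ n) : indelTable x y k k = 2 := by
  induction k, hck using Nat.le_induction with
  | base => exact h₀
  | succ k hck ih =>
    have h₁ := ih (by omega)
    refine indelTable_diag_eq_two (fun h => ?_) ?_
    · have := indelTable_diag_eq_zero_of_le x y hck
        ((indelTable_diag_succ_eq_zero x y k).1 h).1
      omega
    · rw [← h₁]
      exact indelTable_diag_le
        ((hs _ _ (by omega) hkn (by omega) hkn).2 (hR _ (by omega) hkn).symm)

/-- Where the words agree after `c`, the first loop runs down the diagonal to `c`. -/
theorem backtrackUp_descend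
    (hs : ∀ i j, 1 ≤ i → i ≤ n → 1 ≤ j → j ≤ n → (SymEq x y i j ↔ M i = R j))
    (hM : ∀ k, M k ≠ M (k + 1)) {c : ℕ} (hc : 1 ≤ c) (h₀ : indelTable x y c c = 2)
    (hR : ∀ k, c < k → k ≤ n → R k = M k) {k : ℕ} (hck : c ≤ k) (hkn : k ≤ n) :
    backtrackUp x y (indelTable x y) k k = backtrackUp x y (indelTable x y) c c := by
  induction k, hck using Nat.le_induction with
  | base => rfl
  | succ k hck ih =>
    rw [← ih (by omega)]
    refine backtrackUp_diag_of_symEq x y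
      ((hs _ _ (by omega) hkn (by omega) hkn).2 (hR _ (by omega) hkn).symm) ?_
    -- An upward move from a diagonal entry `2` needs a `1` above it, hence a match of `M k` with `R
    -- (k + 1) = M (k + 1)`.
    have h₁ : indelTable x y k (k + 1) ≠ 1 := by
      obtain ⟨i, rfl⟩ : ∃ i, k = i + 1 := ⟨k - 1, by omega⟩
      rw [Ne, indelTable_upper_eq_one, hs _ _ (by omega) (by omega) (by omega) hkn]
      rintro (h | h)
      · have := indelTable_diag_eq_two_of_le hs h₀ hR hck (by omega)
        omega
      · exact hM (i + 1) (h.1.trans (hR _ (by omega) hkn))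
    have := indelTable_diag_eq_two_of_le hs h₀ hR (show c ≤ k + 1 by omega) hkn
    omega

/-- Where the words agree after `c`, the second loop runs down the diagonal to `c` unless the
symbol at `c` can be matched later. -/
theorem backtrackLeft_descend
    (hs : ∀ i j, 1 ≤ i → i ≤ n → 1 ≤ j → j ≤ n → (SymEq x y i j ↔ M i = R j))
    (hM : ∀ k, M k ≠ M (k + 1)) {c : ℕ} (hc : 1 ≤ c) (h₀ : indelTable x y c c = 2)
    (hR : ∀ k, c < k → k ≤ n → R k = M k) (hRc : R c ≠ M (c + 1))
    {k : ℕ} (hck : c ≤ k) (hkn : k ≤ n) :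
    backtrackLeft x y (indelTable x y) k k = backtrackLeft x y (indelTable x y) c c := by
  induction k, hck using Nat.le_induction with
  | base => rfl
  | succ k hck ih =>
    rw [← ih (by omega)]
    refine backtrackLeft_diag_of_symEq x y
      ((hs _ _ (by omega) hkn (by omega) hkn).2 (hR _ (by omega) hkn).symm) ?_
    -- A leftward move would match `M (k + 1)` with `R k`. For `k > c` this is a match of neighbours
    -- in `M`; for `k = c` it is excluded by `hRc`.
    have h₁ : indelTable x y (k + 1) k ≠ 1 := by
      obtain ⟨i, rfl⟩ : ∃ i, k = i + 1 := ⟨k - 1, by omega⟩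
      rw [Ne, indelTable_lower_eq_one, hs _ _ (by omega) (by omega) (by omega) (by omega)]
      rintro (h | h)
      · have := indelTable_diag_eq_two_of_le hs h₀ hR hck (by omega)
        omega
      · rcases Nat.lt_or_ge c (i + 1) with hci | hci
        · exact hM (i + 1) ((hR _ hci (by omega)).symm.trans h.1.symm)
        · obtain rfl : c = i + 1 := by omega
          exact hRc h.1.symm
    have := indelTable_diag_eq_two_of_le hs h₀ hR (show c ≤ k + 1 by omega) hkn
    omega

theorem backtrackLeft_of_lower
    (hs : ∀ i j, 1 ≤ i → i ≤ n → 1 ≤ j → j ≤ n → (SymEq x y i j ↔ M i = R j))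
    (hM : ∀ k, M k ≠ M (k + 1)) {a : ℕ} (ha : 1 ≤ a) (han : a ≤ n)
    (h₀ : indelTable x y a a = 2) (h₁ : indelTable x y a (a - 1) = 1)
    (hR : ∀ k, a < k → k ≤ n → R k = M k) (hRa : a + 1 ≤ n → R a ≠ M (a + 1)) :
    backtrackLeft x y (indelTable x y) n n = some {a} := by
  obtain ⟨i, rfl⟩ : ∃ i, a = i + 1 := ⟨a - 1, by omega⟩
  have h₂ := backtrackLeft_diag_of_lower x y h₀ h₁
  rcases han.eq_or_lt with rfl | hlt
  · exact h₂
  · rw [backtrackLeft_descend hs hM ha h₀ hR (hRa hlt) han le_rfl]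
    exact h₂

theorem symEq_of_table
    (hs : ∀ i j, 1 ≤ i → i ≤ n → 1 ≤ j → j ≤ n → (SymEq x y i j ↔ M i = R j))
    {k : ℕ} (h₀ : indelTable x y k k = 0) {i : ℕ} (hi : 1 ≤ i) (hik : i ≤ k) (hkn : k ≤ n) :
    M i = R i :=
  (indelTable_diag_eq_zero_iff hs hkn).1 h₀ i hi hik

/-- One symbol moved to the left: `y` is `x` with the symbol `b` deleted and a symbol inserted at
`a < b`. -/
theorem backtrack_of_lt
    (hs : ∀ i j, 1 ≤ i → i ≤ n → 1 ≤ j → j ≤ n → (SymEq x y i j ↔ M i = R j))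
    (hM : ∀ k, M k ≠ M (k + 1)) (hM₂ : ∀ k, M k ≠ M (k + 2))
    {a b : ℕ} (ha : 1 ≤ a) (hab : a < b) (hbn : b ≤ n)
    (h₁ : ∀ k, 1 ≤ k → k < a → R k = M k) (h₂ : ∀ k, a ≤ k → k < b → R (k + 1) = M k)
    (h₃ : ∀ k, b < k → k ≤ n → R k = M k) :
    ∃ p q, backtrackUp x y (indelTable x y) n n = some {p} ∧
      backtrackLeft x y (indelTable x y) n n = some {q} ∧ (a = p ∨ a = q) := by
  obtain ⟨a, rfl⟩ : ∃ c, a = c + 1 := ⟨a - 1, by omega⟩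
  obtain ⟨b, rfl⟩ : ∃ c, b = c + 1 := ⟨b - 1, by omega⟩
  have hz : indelTable x y a a = 0 := (indelTable_diag_eq_zero_iff hs (by omega)).2
    fun i hi hia => (h₁ i hi (by omega)).symm
  have hu : ∀ k, a ≤ k → k ≤ b → indelTable x y k (k + 1) = 1 := by
    intro k hak
    induction k, hak using Nat.le_induction with
    | base => exact fun _ => indelTable_upper_of_diag x y hz
    | succ k hak ih =>
      intro hkb
      rw [indelTable_upper_eq_one, hs _ _ (by omega) (by omega) (by omega) (by omega)]
      exact Or.inr ⟨(h₂ _ (by omega) (by omega)).symm, ih (by omega)⟩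
  -- The insertion is now at `a + 1`, so `R (a + 2) = M (a + 1)`, which differs from `M (a + 2)`.
  have hnz : indelTable x y (a + 2) (a + 2) ≠ 0 := fun h =>
    hM (a + 1) ((h₂ _ le_rfl hab).symm.trans
      (symEq_of_table hs h (by omega) le_rfl (by omega)).symm)
  have htwo : indelTable x y (b + 1) (b + 1) = 2 := by
    refine indelTable_diag_eq_two (fun h => hnz (indelTable_diag_eq_zero_of_le x y (by omega) h)) ?_
    have := indelTable_succ_left_le x y b (b + 1)
    have := hu b (by omega) le_rfl
    omega
  have hRb : R (b + 1) = M b := h₂ b (by omega) (by omega)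
  have hUp : backtrackUp x y (indelTable x y) n n = backtrackUp x y (indelTable x y) b (b + 1) := by
    rw [backtrackUp_descend hs hM (by omega) htwo h₃ hbn le_rfl,
      backtrackUp_diag_of_upper x y htwo (hu b (by omega) le_rfl)]
  have hLeft := backtrackLeft_descend hs hM (by omega) htwo h₃
    (by rw [hRb]; exact hM₂ b) hbn le_rfl
  -- On the superdiagonal all pairs beyond `a` match, so the first loop overshoots the insertion
  -- only if the inserted symbol repeats `M a`.
  have hUpA : (1 ≤ a → R (a + 1) ≠ M a) →
      backtrackUp x y (indelTable x y) n n = some {a + 1} := by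
    intro h
    rw [hUp]
    refine backtrackUp_upper_eq x y (by omega) (hu b (by omega) le_rfl) (fun k hk hkb => ?_) ?_
    · rw [hs _ _ (by omega) (by omega) (by omega) (by omega)]
      exact (h₂ _ (by omega) (by omega)).symm
    · rintro hsym
      have ha1 : 1 ≤ a := by obtain ⟨c, d, h, -⟩ := hsym; omega
      rw [hs _ _ ha1 (by omega) (by omega) (by omega)] at hsym
      exact h ha1 hsym.symm
  by_cases hl : indelTable x y (b + 1) b = 1
  · rw [hLeft, backtrackLeft_diag_of_lower x y htwo hl]
    refine ⟨a + 1, b + 1, hUpA fun ha1 hRa => ?_, rfl, Or.inl rfl⟩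
    -- the only way down on the left is to pair every symbol with its right neighbour
    obtain ⟨b, rfl⟩ : ∃ c, b = c + 1 := ⟨b - 1, by omega⟩
    rcases (indelTable_lower_eq_one x y b).1 hl with h | h
    · have := symEq_of_table hs h (i := a + 1) (by omega) (by omega) (by omega)
      exact hM a (hRa.symm.trans this.symm)
    · rw [hs _ _ (by omega) (by omega) (by omega) (by omega)] at h
      rcases Nat.lt_or_ge (a + 1) (b + 1) with hlt | hge
      · exact hM₂ b ((h₂ b (by omega) (by omega)).symm.trans h.1.symm)
      · obtain rfl : a = b := by omega
        exact hM₂ a (hRa.symm.trans h.1.symm)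
  · have hne : ¬ SymEq x y (b + 1) (b + 1) := by
      rw [hs _ _ (by omega) hbn (by omega) hbn, hRb]
      exact fun h => hM b h.symm
    rw [backtrackLeft_diag_of_upper x y htwo (hu b (by omega) le_rfl) hl hne] at hLeft
    -- The second loop finds the first disagreement of the words. That is `a + 1` unless the
    -- inserted symbol happens to equal `M (a + 1)`; then it is not `M a`, and the first loop finds
    -- `a + 1`.
    by_cases hRa : R (a + 1) = M (a + 1)
    · have hz' : indelTable x y (a + 1) (a + 1) = 0 := by
        rw [indelTable_diag_succ_eq_zero, hs _ _ (by omega) (by omega) (by omega) (by omega)]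
        exact ⟨hz, hRa.symm⟩
      refine ⟨a + 1, a + 2, hUpA fun _ h => hM a (h.symm.trans hRa), ?_, Or.inl rfl⟩
      rw [hLeft]
      exact backtrackLeft_upper_eq x y (by omega) (hu b (by omega) le_rfl) hz' hnz
    · obtain ⟨p, hp⟩ := exists_backtrackUp_upper x y (hu b (by omega) le_rfl)
      refine ⟨p, a + 1, hUp.trans hp, ?_, Or.inr rfl⟩
      rw [hLeft]
      refine backtrackLeft_upper_eq x y (by omega) (hu b (by omega) le_rfl) hz fun h => hRa ?_
      exact (symEq_of_table hs h (by omega) le_rfl (by omega)).symm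

/-- One symbol replaced. -/
theorem backtrack_of_eq
    (hs : ∀ i j, 1 ≤ i → i ≤ n → 1 ≤ j → j ≤ n → (SymEq x y i j ↔ M i = R j))
    (hM : ∀ k, M k ≠ M (k + 1)) (hM₂ : ∀ k, M k ≠ M (k + 2))
    {a : ℕ} (ha : 1 ≤ a) (han : a ≤ n) (h₁ : ∀ k, 1 ≤ k → k < a → R k = M k)
    (hRa : R a ≠ M a) (h₃ : ∀ k, a < k → k ≤ n → R k = M k) :
    ∃ p q, backtrackUp x y (indelTable x y) n n = some {p} ∧
      backtrackLeft x y (indelTable x y) n n = some {q} ∧ (a = p ∨ a = q) := by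
  obtain ⟨a, rfl⟩ : ∃ c, a = c + 1 := ⟨a - 1, by omega⟩
  have hz : indelTable x y a a = 0 := (indelTable_diag_eq_zero_iff hs (by omega)).2
    fun i hi hia => (h₁ i hi (by omega)).symm
  have hu := indelTable_upper_of_diag x y hz
  have hl := indelTable_lower_of_diag x y hz
  have htwo : indelTable x y (a + 1) (a + 1) = 2 := by
    refine indelTable_diag_eq_two (fun h => hRa ?_) ?_
    · exact (symEq_of_table hs h (by omega) le_rfl han).symm
    · have := indelTable_succ_left_le x y a (a + 1)
      omega
  have hUp : backtrackUp x y (indelTable x y) n n = backtrackUp x y (indelTable x y) a (a + 1) := by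
    rw [backtrackUp_descend hs hM (by omega) htwo h₃ han le_rfl,
      backtrackUp_diag_of_upper x y htwo hu]
  -- The only obstruction to the second loop descending the diagonal to `a + 1`. In that case `R (a
  -- + 1) ≠ M a`, so the first loop does not overshoot.
  by_cases hcase : a + 2 ≤ n ∧ R (a + 1) = M (a + 2)
  · obtain ⟨hn, hR⟩ := hcase
    have htwo' := indelTable_diag_eq_two_of_le hs htwo h₃ (Nat.le_succ (a + 1)) hn
    have hl' : indelTable x y (a + 2) (a + 1) = 1 := by
      rw [indelTable_lower_eq_one, hs _ _ (by omega) hn (by omega) han]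
      exact Or.inr ⟨hR.symm, hl⟩
    refine ⟨a + 1, a + 2, ?_, ?_, Or.inl rfl⟩
    · rw [hUp]
      refine backtrackUp_upper_eq x y le_rfl hu (fun k hk hk' => by omega) fun hsym => ?_
      have ha1 : 1 ≤ a := by obtain ⟨c, d, h, -⟩ := hsym; omega
      rw [hs _ _ ha1 (by omega) (by omega) han] at hsym
      exact hM₂ a (hsym.trans hR)
    · refine backtrackLeft_of_lower hs hM (by omega) hn htwo' hl'
        (fun k hk hkn => h₃ k (by omega) hkn) fun _ => ?_
      rw [h₃ _ (by omega) hn]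
      exact hM _
  · obtain ⟨p, hp⟩ := exists_backtrackUp_upper x y hu
    refine ⟨p, a + 1, hUp.trans hp, ?_, Or.inr rfl⟩
    exact backtrackLeft_of_lower hs hM (by omega) han htwo hl h₃ fun h h' => hcase ⟨h, h'⟩

/-- One symbol moved to the right: `y` is `x` with the symbol `b` deleted and a symbol inserted at
`a > b`. -/
theorem backtrack_of_gt
    (hs : ∀ i j, 1 ≤ i → i ≤ n → 1 ≤ j → j ≤ n → (SymEq x y i j ↔ M i = R j))
    (hM : ∀ k, M k ≠ M (k + 1)) (hM₂ : ∀ k, M k ≠ M (k + 2))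
    {a b : ℕ} (hb : 1 ≤ b) (hba : b < a) (han : a ≤ n)
    (h₁ : ∀ k, 1 ≤ k → k < b → R k = M k) (h₂ : ∀ k, b ≤ k → k < a → R k = M (k + 1))
    (h₃ : ∀ k, a < k → k ≤ n → R k = M k) :
    ∃ p q, backtrackUp x y (indelTable x y) n n = some {p} ∧
      backtrackLeft x y (indelTable x y) n n = some {q} ∧ (a = p ∨ a = q) := by
  obtain ⟨a, rfl⟩ : ∃ c, a = c + 1 := ⟨a - 1, by omega⟩
  obtain ⟨b, rfl⟩ : ∃ c, b = c + 1 := ⟨b - 1, by omega⟩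
  have hz : indelTable x y b b = 0 := (indelTable_diag_eq_zero_iff hs (by omega)).2
    fun i hi hia => (h₁ i hi (by omega)).symm
  have hl : ∀ k, b ≤ k → k ≤ a → indelTable x y (k + 1) k = 1 := by
    intro k hbk
    induction k, hbk using Nat.le_induction with
    | base => exact fun _ => indelTable_lower_of_diag x y hz
    | succ k hak ih =>
      intro hkb
      rw [indelTable_lower_eq_one, hs _ _ (by omega) (by omega) (by omega) (by omega)]
      exact Or.inr ⟨(h₂ _ (by omega) (by omega)).symm, ih (by omega)⟩
  have hnz : ∀ k, b + 1 ≤ k → k ≤ n → indelTable x y k k ≠ 0 := fun k hk hkn h =>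
    hM (b + 1) ((symEq_of_table hs h (by omega) hk hkn).trans (h₂ _ le_rfl hba))
  have htwo : ∀ k, b ≤ k → k ≤ a → indelTable x y (k + 1) (k + 1) = 2 := by
    intro k hbk hka
    refine indelTable_diag_eq_two (hnz _ (by omega) (by omega)) ?_
    have := indelTable_succ_right_le x y (k + 1) k
    have := hl k hbk hka
    omega
  -- Where the diagonal symbols differ, the first loop leaves the diagonal upwards or to the left,
  -- and either way collects exactly one index.
  have hend : ∀ k, b ≤ k → k ≤ a → ¬ SymEq x y (k + 1) (k + 1) →
      ∃ p, backtrackUp x y (indelTable x y) (k + 1) (k + 1) = some {p} := by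
    intro k hbk hka hsym
    by_cases hu : indelTable x y k (k + 1) = 1
    · rw [backtrackUp_diag_of_upper x y (htwo k hbk hka) hu]
      exact exists_backtrackUp_upper x y hu
    · exact ⟨_, backtrackUp_diag_of_lower x y (htwo k hbk hka) (hl k hbk hka) hu hsym⟩
  have hUp := backtrackUp_descend hs hM (by omega) (htwo a (by omega) le_rfl) h₃ han le_rfl
  obtain ⟨p, hp⟩ : ∃ p, backtrackUp x y (indelTable x y) (a + 1) (a + 1) = some {p} := by
    by_cases hsym : SymEq x y (a + 1) (a + 1)
    · by_cases hu : indelTable x y a (a + 1) = 1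
      · rw [backtrackUp_diag_of_upper x y (htwo a (by omega) le_rfl) hu]
        exact exists_backtrackUp_upper x y hu
      · have := htwo a (by omega) le_rfl
        -- A match at the inserted symbol costs one diagonal step. The next pair is `M a` against `R
        -- a = M (a + 1)`, which cannot match.
        rw [backtrackUp_diag_of_symEq x y hsym (by omega)]
        obtain ⟨k, rfl⟩ : ∃ c, a = c + 1 := ⟨a - 1, by omega⟩
        refine hend k (by omega) (by omega) ?_
        rw [hs _ _ (by omega) (by omega) (by omega) (by omega), h₂ _ (by omega) (by omega)]
        exact hM _
    · exact hend a (by omega) le_rfl hsym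
  replace htwo := htwo a (by omega) le_rfl
  by_cases hcase : a + 2 ≤ n ∧ R (a + 1) = M (a + 2)
  · obtain ⟨hn, hR⟩ := hcase
    have htwo' := indelTable_diag_eq_two_of_le hs htwo h₃ (Nat.le_succ (a + 1)) hn
    have hl' : indelTable x y (a + 2) (a + 1) = 1 := by
      rw [indelTable_lower_eq_one, hs _ _ (by omega) hn (by omega) han]
      exact Or.inr ⟨hR.symm, hl a (by omega) le_rfl⟩
    -- With `R (a + 1) = M (a + 2)`, the symbol `R (a + 1)` matches neither `M a` nor `M (a + 1)`.
    -- The first loop is therefore forced to its last branch at `(a + 1, a + 1)` and collects `a +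
    -- 1`.
    have hu : indelTable x y a (a + 1) ≠ 1 := by
      obtain ⟨a, rfl⟩ : ∃ c, a = c + 1 := ⟨a - 1, by omega⟩
      rw [Ne, indelTable_upper_eq_one, hs _ _ (by omega) (by omega) (by omega) han]
      rintro (h | h)
      · exact hnz _ (by omega) (by omega) h
      · exact hM₂ (a + 1) (h.1.trans hR)
    have hsym : ¬ SymEq x y (a + 1) (a + 1) := by
      rw [hs _ _ (by omega) han (by omega) han, hR]
      exact hM _
    refine ⟨a + 1, a + 2, ?_, ?_, Or.inl rfl⟩
    · rw [hUp, backtrackUp_diag_of_lower x y htwo (hl a (by omega) le_rfl) hu hsym]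
    · refine backtrackLeft_of_lower hs hM (by omega) hn htwo' hl'
        (fun k hk hkn => h₃ k (by omega) hkn) fun _ => ?_
      rw [h₃ _ (by omega) hn]
      exact hM _
  · refine ⟨p, a + 1, hUp.trans hp, ?_, Or.inr rfl⟩
    exact backtrackLeft_of_lower hs hM (by omega) han htwo (hl a (by omega) le_rfl) h₃
      fun h h' => hcase ⟨h, h'⟩

end Backtracking

/-! ### The periodic sequence and its one-symbol modifications. -/

section Periodic

/-- The symbols of the periodic sequence, counted from `1`. -/
def periodicNat (t k : ℕ) : ℕ := (k + t) % (t + 1)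

/-- The symbols of a word, counted from `1`. -/
def wordNat {n t : ℕ} (r : Fin n → Fin (t + 1)) (k : ℕ) : ℕ :=
  if h : k - 1 < n then (r ⟨k - 1, h⟩).val else 0

theorem periodicNat_succ (t k : ℕ) : periodicNat t (k + 1) = k % (t + 1) := by
  rw [periodicNat, show k + 1 + t = k + (t + 1) by ring, Nat.add_mod_right]

theorem periodicNat_ne_succ {t : ℕ} (ht : 2 ≤ t) (k : ℕ) :
    periodicNat t k ≠ periodicNat t (k + 1) := by
  unfold periodicNat
  intro h
  have h₁ : k + t ≡ k + t + 1 [MOD t + 1] := by rw [Nat.ModEq, h]; congr 1; ring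
  have h₂ := (Nat.modEq_iff_dvd' (by omega)).1 h₁
  have h₃ := Nat.le_of_dvd (by omega) h₂
  omega

/-- `t + 1 ≥ 3` does not divide `2`. With `periodicNat_ne_succ`, three consecutive symbols are
distinct; adding `t` in `periodicNat` instead of subtracting `1` makes this valid from `k = 0` on.
-/
theorem periodicNat_ne_add_two {t : ℕ} (ht : 2 ≤ t) (k : ℕ) :
    periodicNat t k ≠ periodicNat t (k + 2) := by
  unfold periodicNat
  intro h
  have h₁ : k + t ≡ k + t + 2 [MOD t + 1] := by rw [Nat.ModEq, h]; congr 1; ring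
  have h₂ := (Nat.modEq_iff_dvd' (by omega)).1 h₁
  have h₃ := Nat.le_of_dvd (by omega) h₂
  omega

theorem wordNat_succ {n t : ℕ} (r : Fin n → Fin (t + 1)) (k : Fin n) :
    wordNat r (k.val + 1) = (r k).val := by
  simp [wordNat]

theorem periodicSeq_val (n t : ℕ) (k : Fin n) :
    (periodicSeq n t k).val = periodicNat t (k.val + 1) := by
  rw [periodicNat_succ]; rfl

theorem symEq_periodicSeq {n t : ℕ} (r : Fin n → Fin (t + 1)) (i j : ℕ) (hi : 1 ≤ i) (hin : i ≤ n)
    (hj : 1 ≤ j) (hjn : j ≤ n) :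
    SymEq (periodicSeq n t) r i j ↔ periodicNat t i = wordNat r j := by
  obtain ⟨i, rfl⟩ : ∃ k, i = k + 1 := ⟨i - 1, by omega⟩
  obtain ⟨j, rfl⟩ : ∃ k, j = k + 1 := ⟨j - 1, by omega⟩
  have h₁ := periodicSeq_val n t ⟨i, by omega⟩
  have h₂ := wordNat_succ r ⟨j, by omega⟩
  simp only at h₁ h₂
  rw [h₂, ← h₁, ← Fin.ext_iff]
  constructor
  · rintro ⟨a, b, ha, hb, h⟩
    rwa [show a = ⟨i, by omega⟩ from Fin.ext (by simpa using ha),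
      show b = ⟨j, by omega⟩ from Fin.ext (by simpa using hb)] at h
  · exact fun h => ⟨_, _, rfl, rfl, h⟩

theorem wordNat_of_comp_succAbove {n t : ℕ} {r : Fin (n + 1) → Fin (t + 1)} {a b : Fin (n + 1)}
    (h : ∀ k, r (a.succAbove k) = periodicSeq (n + 1) t (b.succAbove k)) {k : ℕ} (hk : k < n) :
    wordNat r ((if k < a.val then k else k + 1) + 1) =
      periodicNat t ((if k < b.val then k else k + 1) + 1) := by
  have h₁ := congrArg Fin.val (h ⟨k, hk⟩)
  have hv : ∀ c : Fin (n + 1), (c.succAbove ⟨k, hk⟩).val = if k < c.val then k else k + 1 := by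
    intro c
    simp only [Fin.succAbove, Fin.lt_def, Fin.val_castSucc]
    split_ifs <;> simp
  rw [← wordNat_succ, periodicSeq_val, hv, hv] at h₁
  exact h₁

/-- If `r` is the periodic sequence with the symbol at `b` deleted and a symbol inserted at `a`,
the two backtracking subroutines collect one index each, and one of them is `a`. -/
theorem subroutines_of_comp_succAbove {n t : ℕ} (ht : 2 ≤ t) {r : Fin (n + 1) → Fin (t + 1)}
    {a b : Fin (n + 1)}
    (h : ∀ k, r (a.succAbove k) = periodicSeq (n + 1) t (b.succAbove k))
    (hr : r ≠ periodicSeq (n + 1) t) :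
    ∃ p q, subroutineOne (periodicSeq (n + 1) t) r = some {p} ∧
      subroutineTwo (periodicSeq (n + 1) t) r = some {q} ∧ (a.val + 1 = p ∨ a.val + 1 = q) := by
  have hs := symEq_periodicSeq r
  have hM := periodicNat_ne_succ ht
  have hM₂ := periodicNat_ne_add_two ht
  have hw := fun k => wordNat_of_comp_succAbove h (k := k)
  have hlow : ∀ k, 1 ≤ k → k < a.val + 1 → k < b.val + 1 → wordNat r k = periodicNat t k := by
    intro k hk hka hkb
    have := hw (k - 1) (by omega)
    rwa [if_pos (by omega), if_pos (by omega), Nat.sub_add_cancel hk] at this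
  have hhigh : ∀ k, a.val + 1 < k → b.val + 1 < k → k ≤ n + 1 →
      wordNat r k = periodicNat t k := by
    intro k hka hkb hk
    have := hw (k - 2) (by omega)
    rwa [if_neg (by omega), if_neg (by omega), show k - 2 + 1 + 1 = k by omega] at this
  rcases lt_trichotomy a.val b.val with hab | hab | hab
  · refine backtrack_of_lt hs hM hM₂ (a := a.val + 1) (b := b.val + 1) (by omega) (by omega)
      (by omega) (fun k hk hka => hlow k hk hka (by omega)) (fun k hak hkb => ?_)
      (fun k hbk hk => hhigh k (by omega) hbk hk)
    have := hw (k - 1) (by omega)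
    rwa [if_neg (by omega), if_pos (by omega), Nat.sub_add_cancel (by omega)] at this
  · refine backtrack_of_eq hs hM hM₂ (a := a.val + 1) (by omega) (by omega)
      (fun k hk hka => hlow k hk hka (by omega)) (fun hRa => hr ?_)
      (fun k hbk hk => hhigh k (by omega) (by omega) hk)
    -- If the replaced symbol agreed with the periodic one, `r` would be the periodic sequence.
    obtain rfl : a = b := Fin.ext hab
    funext k
    rcases Fin.eq_self_or_eq_succAbove a k with rfl | ⟨j, rfl⟩
    · exact Fin.ext (by rw [periodicSeq_val, ← hRa, wordNat_succ])
    · exact h j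
  · refine backtrack_of_gt hs hM hM₂ (a := a.val + 1) (b := b.val + 1) (by omega) (by omega)
      (by omega) (fun k hk hka => hlow k hk (by omega) hka) (fun k hak hkb => ?_)
      (fun k hbk hk => hhigh k hbk (by omega) hk)
    have := hw (k - 1) (by omega)
    rwa [if_pos (by omega), if_neg (by omega), Nat.sub_add_cancel (by omega)] at this

/-- All runs have length one: at the smaller of the two positions, one word shows the symbol there
and the other shows its successor. -/
theorem eq_of_periodicSeq_comp_succAbove {n t : ℕ} (ht : 2 ≤ t) {a b : Fin (n + 1)}
    (h : ∀ k, periodicSeq (n + 1) t (a.succAbove k) = periodicSeq (n + 1) t (b.succAbove k)) :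
    a = b := by
  have hw : ∀ k, k < n → periodicNat t ((if k < a.val then k else k + 1) + 1) =
      periodicNat t ((if k < b.val then k else k + 1) + 1) := by
    intro k hk
    rw [← wordNat_of_comp_succAbove h hk,
      ← wordNat_of_comp_succAbove (r := periodicSeq (n + 1) t) (fun _ => rfl) hk]
  refine Fin.ext ?_
  rcases lt_trichotomy a.val b.val with hab | hab | hab
  · have := hw a.val (by omega)
    rw [if_neg (by omega), if_pos hab] at this
    exact absurd this.symm (periodicNat_ne_succ ht _)
  · exact hab
  · have := hw b.val (by omega)
    rw [if_pos hab, if_neg (by omega)] at this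
    exact absurd this (periodicNat_ne_succ ht _)

end Periodic

set_option linter.unusedSectionVars false

/-! ### Kraus operators, exact recovery and the Knill–Laflamme conditions. -/

section Channels

variable {A B ι : Type*} [Fintype A] [DecidableEq A] [Fintype B] [DecidableEq B] [Fintype ι]

/-- The completely positive map with the given Kraus operators. -/
def krausMap (K : ι → Matrix B A ℂ) : Matrix A A ℂ →ₗ[ℂ] Matrix B B ℂ where
  toFun ρ := ∑ a, K a * ρ * (K a)ᴴ
  map_add' ρ σ := by simp [Matrix.mul_add, Matrix.add_mul, Finset.sum_add_distrib]
  map_smul' c ρ := by simp [Finset.smul_sum]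

theorem krausMap_apply (K : ι → Matrix B A ℂ) (ρ : Matrix A A ℂ) :
    krausMap K ρ = ∑ a, K a * ρ * (K a)ᴴ := rfl

theorem isChannel_krausMap {K : ι → Matrix B A ℂ} (hK : ∑ a, (K a)ᴴ * K a = 1) :
    IsChannel (krausMap K) := by
  let e := Fintype.equivFin ι
  refine ⟨Fintype.card ι, fun a => K (e.symm a), ?_, fun ρ => ?_⟩
  · rw [← hK]
    exact Equiv.sum_comp e.symm fun a => (K a)ᴴ * K a
  · exact (Equiv.sum_comp e.symm fun a => K a * ρ * (K a)ᴴ).symm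

theorem IsChannel.trace_apply {Φ : Matrix A A ℂ →ₗ[ℂ] Matrix B B ℂ} (hΦ : IsChannel Φ)
    (ρ : Matrix A A ℂ) : (Φ ρ).trace = ρ.trace := by
  obtain ⟨k, K, hK, h⟩ := hΦ
  rw [h, trace_sum]
  calc ∑ a, (K a * ρ * (K a)ᴴ).trace = ∑ a, ((K a)ᴴ * K a * ρ).trace :=
        Finset.sum_congr rfl fun a _ => by rw [trace_mul_comm, Matrix.mul_assoc]
    _ = ρ.trace := by rw [← trace_sum, ← Matrix.sum_mul, hK, Matrix.one_mul]

theorem exists_isChannel [Nonempty B] : ∃ Φ : Matrix A A ℂ →ₗ[ℂ] Matrix B B ℂ, IsChannel Φ := by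
  obtain ⟨b⟩ := ‹Nonempty B›
  refine ⟨krausMap fun a : A => single b a (1 : ℂ), isChannel_krausMap ?_⟩
  simp [sum_single_one]

/-- If a sum of rank-one operators is a pure state, every summand is proportional to it. -/
theorem eq_smul_of_sum_vecMulVec {v : ι → B → ℂ} {μ : B → ℂ} (hμ : star μ ⬝ᵥ μ = 1)
    (h : ∑ a, vecMulVec (v a) (star (v a)) = vecMulVec μ (star μ)) (a : ι) :
    v a = (star μ ⬝ᵥ v a) • μ := by
  set w := v a - (star μ ⬝ᵥ v a) • μ with hw
  have hμw : star μ ⬝ᵥ w = 0 := by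
    rw [hw, dotProduct_sub, dotProduct_smul, hμ]; simp
  -- Evaluate both sides of `h` as quadratic forms at `w`, the component of `v a` orthogonal to `μ`;
  -- a sum of squared moduli vanishes.
  have h₁ : ∑ b, star (star (v b) ⬝ᵥ w) * (star (v b) ⬝ᵥ w) = 0 := by
    have h₂ := congrArg (fun X => star w ⬝ᵥ (X *ᵥ w)) h
    simp only [sum_mulVec, vecMulVec_mulVec, dotProduct_sum, hμw] at h₂
    simp only [MulOpposite.op_zero, zero_smul, dotProduct_zero, op_smul_eq_smul, dotProduct_smul,
      smul_eq_mul] at h₂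
    rw [← h₂]
    refine Finset.sum_congr rfl fun b _ => ?_
    rw [← star_dotProduct, mul_comm]
  have h₂ : star (v a) ⬝ᵥ w = 0 := by
    have := (Finset.sum_eq_zero_iff_of_nonneg fun b _ => star_mul_self_nonneg _).1 h₁ a (mem_univ a)
    simpa using this
  have h₃ : star w ⬝ᵥ w = 0 := by
    have h₄ : star w = star (v a) - star (star μ ⬝ᵥ v a) • star μ := by
      rw [hw, star_sub, star_smul]
    rw [h₄, sub_dotProduct, smul_dotProduct, h₂, hμw]; simp
  have h₅ : w = 0 := dotProduct_star_self_eq_zero.1 h₃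
  exact sub_eq_zero.1 h₅

/-- After normalisation every vector is an eigenvector, so `T` is a scalar. -/
theorem mem_span_one_of_forall_unit {T : Matrix B B ℂ}
    (h : ∀ μ : B → ℂ, star μ ⬝ᵥ μ = 1 → ∃ c : ℂ, T *ᵥ μ = c • μ) :
    T ∈ Submodule.span ℂ {(1 : Matrix B B ℂ)} := by
  have key : ∀ v : B → ℂ, ∃ c : ℂ, T *ᵥ v = c • v := by
    intro v
    by_cases hv : v = 0
    · exact ⟨0, by simp [hv]⟩
    · have hpos : 0 < ∑ i, ‖v i‖ ^ 2 := by
        obtain ⟨i, hi⟩ := Function.ne_iff.1 hv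
        exact Finset.sum_pos' (fun _ _ => by positivity)
          ⟨i, mem_univ i, by have : v i ≠ 0 := hi; positivity⟩
      set s : ℂ := Complex.ofReal (√(∑ i, ‖v i‖ ^ 2))⁻¹ with hs
      have hs0 : s ≠ 0 := by
        rw [hs]; exact_mod_cast (inv_pos.2 (Real.sqrt_pos.2 hpos)).ne'
      have hvv : star v ⬝ᵥ v = ((∑ i, ‖v i‖ ^ 2 : ℝ) : ℂ) := by
        simp [dotProduct, Complex.conj_mul']
      obtain ⟨c, hc⟩ := h (s • v) (by
        rw [star_smul, smul_dotProduct, dotProduct_smul, hvv, hs, Complex.star_def,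
          Complex.conj_ofReal, smul_eq_mul, smul_eq_mul, ← Complex.ofReal_mul,
          ← Complex.ofReal_mul, ← mul_assoc, ← mul_inv, Real.mul_self_sqrt hpos.le,
          inv_mul_cancel₀ hpos.ne', Complex.ofReal_one])
      refine ⟨c, smul_right_injective _ hs0 ?_⟩
      simp only
      rw [← mulVec_smul, hc, smul_comm]
  obtain ⟨c, hc⟩ := LinearMap.exists_eq_smul_id_of_forall_notLinearIndependent (f := T.toLin')
    fun v hli => by
      obtain ⟨c, hc⟩ := key v
      rw [toLin'_apply, hc] at hli
      have := LinearIndependent.pair_iff.1 hli c (-1) (by simp)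
      simp at this
  rw [Submodule.mem_span_singleton]
  refine ⟨c, ?_⟩
  apply (Matrix.toLin' (R := ℂ)).injective
  rw [hc, map_smul, toLin'_one]
  rfl

/-- A decoder that returns every message acts on the code as a multiple of the identity. -/
theorem kraus_mul_mem_span_one {K : ι → Matrix B A ℂ} {W : Matrix A B ℂ}
    (h : ∀ μ : B → ℂ, star μ ⬝ᵥ μ = 1 →
      ∑ a, K a * vecMulVec (W *ᵥ μ) (star (W *ᵥ μ)) * (K a)ᴴ = vecMulVec μ (star μ)) (a : ι) :
    K a * W ∈ Submodule.span ℂ {(1 : Matrix B B ℂ)} := by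
  refine mem_span_one_of_forall_unit fun μ hμ => ⟨_, eq_smul_of_sum_vecMulVec hμ
    (v := fun a => (K a * W) *ᵥ μ) ?_ a⟩
  rw [← h μ hμ]
  refine Finset.sum_congr rfl fun b _ => ?_
  rw [mul_vecMulVec, vecMulVec_mul, mulVec_mulVec, vecMul_conjTranspose, star_star, mulVec_mulVec]

/-- If `K a * G = c a • 1`, trace preservation and the isometry property give `∑ |c a|² = 1`. -/
theorem krausMap_apply_of_mem_span_one {K : ι → Matrix B A ℂ} (hK : ∑ a, (K a)ᴴ * K a = 1)
    {G : Matrix A B ℂ} (hG : Gᴴ * G = 1)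
    (h : ∀ a, K a * G ∈ Submodule.span ℂ {(1 : Matrix B B ℂ)}) (τ : Matrix B B ℂ) :
    krausMap K (G * τ * Gᴴ) = τ := by
  simp only [Submodule.mem_span_singleton] at h
  choose c hc using h
  have h₁ : ∑ a, (c a * star (c a)) • (1 : Matrix B B ℂ) = 1 := by
    calc ∑ a, (c a * star (c a)) • (1 : Matrix B B ℂ)
        = ∑ a, Gᴴ * ((K a)ᴴ * K a) * G := Finset.sum_congr rfl fun a _ => by
          rw [show Gᴴ * ((K a)ᴴ * K a) * G = (K a * G)ᴴ * (K a * G) by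
            simp only [conjTranspose_mul, Matrix.mul_assoc], ← hc a]
          simp [smul_smul]
      _ = 1 := by rw [← Matrix.sum_mul, ← Matrix.mul_sum, hK, Matrix.mul_one, hG]
  calc krausMap K (G * τ * Gᴴ) = ∑ a, (K a * G) * τ * (K a * G)ᴴ := by
        simp only [krausMap_apply, conjTranspose_mul, Matrix.mul_assoc]
    _ = ∑ a, ((c a * star (c a)) • (1 : Matrix B B ℂ)) * τ := by
        refine Finset.sum_congr rfl fun a _ => ?_
        rw [← hc a]
        simp [smul_smul, mul_comm]
    _ = τ := by rw [← Matrix.sum_mul, h₁, Matrix.one_mul]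

/-- The errors `G k` act on the code as mutually orthogonal multiples of isometries: recovery. -/
theorem exists_recovery_of_orthogonal [DecidableEq ι] [Nonempty B] (G : ι → Matrix A B ℂ)
    (d : ι → ℝ) (hG : ∀ k k', (G k)ᴴ * G k' = if k = k' then (d k : ℂ) • 1 else 0) :
    ∃ Φ : Matrix A A ℂ →ₗ[ℂ] Matrix B B ℂ, IsChannel Φ ∧
      ∀ H ∈ Submodule.span ℂ (Set.range G), Hᴴ * H = 1 → ∀ τ, Φ (H * τ * Hᴴ) = τ := by
  obtain ⟨b⟩ := ‹Nonempty B›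
  have hd : ∀ k, 0 ≤ d k := by
    intro k
    have h := congrFun (congrFun (hG k k) b) b
    have h₂ := (posSemidef_conjTranspose_mul_self (G k)).diag_nonneg (i := b)
    rw [h] at h₂
    simpa using h₂
  have hzero : ∀ k, d k = 0 → G k = 0 := by
    intro k hk
    have h := hG k k
    rw [if_pos rfl, hk, Complex.ofReal_zero, zero_smul] at h
    exact conjTranspose_mul_self_eq_zero.1 h
  set P : Matrix A A ℂ := ∑ k, ((d k)⁻¹ : ℂ) • (G k * (G k)ᴴ) with hP
  have hPG : ∀ k, P * G k = G k := by
    intro k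
    rw [hP, Matrix.sum_mul, Finset.sum_eq_single k]
    · rw [smul_mul, Matrix.mul_assoc, hG, if_pos rfl, Matrix.mul_smul, Matrix.mul_one, smul_smul]
      by_cases hk : d k = 0
      · rw [hzero k hk, smul_zero]
      · rw [inv_mul_cancel₀ (by exact_mod_cast hk), one_smul]
    · intro k' _ hk'
      rw [smul_mul, Matrix.mul_assoc, hG, if_neg hk', Matrix.mul_zero, smul_zero]
    · simp
  have hPP : P * P = P := by
    conv_lhs => rw [hP]
    rw [← hP, Matrix.mul_sum]
    conv_rhs => rw [hP]
    exact Finset.sum_congr rfl fun k _ => by rw [Matrix.mul_smul, ← Matrix.mul_assoc, hPG]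
  have hPH : Pᴴ = P := by
    rw [hP, conjTranspose_sum]
    exact Finset.sum_congr rfl fun k _ => by simp
  -- Normalised adjoints undo the errors; the remaining operators send the complement `1 - P` to the
  -- basis state `b` and make the map trace preserving. If `d k = 0`, then `G k = 0`, and the
  -- convention `0⁻¹ = 0` is harmless.
  let K : ι ⊕ A → Matrix B A ℂ := Sum.elim (fun k => ((√(d k))⁻¹ : ℂ) • (G k)ᴴ)
    fun a => single b a (1 : ℂ) * (1 - P)
  have hK : ∑ a, (K a)ᴴ * K a = 1 := by
    have h₁ : ∑ k, (K (.inl k))ᴴ * K (.inl k) = P := by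
      rw [hP]
      refine Finset.sum_congr rfl fun k _ => ?_
      simp only [K, Sum.elim_inl, conjTranspose_smul, conjTranspose_conjTranspose, smul_mul,
        Matrix.mul_smul, smul_smul]
      congr 1
      simp only [star_inv₀, Complex.star_def, Complex.conj_ofReal, ← mul_inv, ← Complex.ofReal_mul]
      rw [Real.mul_self_sqrt (hd k)]
    have h₂ : ∑ a, (K (.inr a))ᴴ * K (.inr a) = 1 - P := by
      have : ∀ a, (K (.inr a))ᴴ * K (.inr a) = (1 - P) * single a a 1 * (1 - P) := by
        intro a
        simp only [K, Sum.elim_inr, conjTranspose_mul, conjTranspose_sub, hPH, conjTranspose_one,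
          conjTranspose_single, star_one]
        rw [Matrix.mul_assoc, ← Matrix.mul_assoc (single a b (1 : ℂ)), single_mul_single_same,
          Matrix.mul_assoc, one_mul]
      rw [Finset.sum_congr rfl fun a _ => this a, ← Matrix.sum_mul, ← Matrix.mul_sum,
        sum_single_one, Matrix.mul_one, Matrix.sub_mul, Matrix.mul_sub, Matrix.mul_sub, hPP]
      simp
    rw [Fintype.sum_sum_type, h₁, h₂, add_sub_cancel]
  refine ⟨krausMap K, isChannel_krausMap hK, fun H hH hHH =>
    krausMap_apply_of_mem_span_one hK hHH fun a => ?_⟩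
  clear hHH
  induction hH using Submodule.span_induction with
  | zero => rw [Matrix.mul_zero]; exact zero_mem _
  | add X Y _ _ hX hY => rw [Matrix.mul_add]; exact add_mem hX hY
  | smul c X _ hX => rw [Matrix.mul_smul]; exact Submodule.smul_mem _ _ hX
  | mem X hX =>
    obtain ⟨k', rfl⟩ := hX
    rcases a with k | a
    · simp only [K, Sum.elim_inl, smul_mul, hG]
      refine Submodule.smul_mem _ _ ?_
      split_ifs
      · exact Submodule.smul_mem _ _ (Submodule.mem_span_singleton_self _)
      · exact zero_mem _
    · simp only [K, Sum.elim_inr, Matrix.mul_assoc, Matrix.sub_mul, hPG, Matrix.one_mul, sub_self,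
        Matrix.mul_zero]
      exact zero_mem _

/-- The Knill–Laflamme conditions suffice for recovery. -/
theorem exists_recovery [DecidableEq ι] [Nonempty B] (F : ι → Matrix A B ℂ)
    (hF : ∀ e f, (F e)ᴴ * F f ∈ Submodule.span ℂ {(1 : Matrix B B ℂ)}) :
    ∃ Φ : Matrix A A ℂ →ₗ[ℂ] Matrix B B ℂ, IsChannel Φ ∧
      ∀ H ∈ Submodule.span ℂ (Set.range F), Hᴴ * H = 1 → ∀ τ, Φ (H * τ * Hᴴ) = τ := by
  obtain ⟨b⟩ := id ‹Nonempty B›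
  simp only [Submodule.mem_span_singleton] at hF
  choose C hC using hF
  have hherm : (Matrix.of C).IsHermitian := by
    ext e f
    have h := congrFun (congrFun (congrArg conjTranspose (hC f e)) b) b
    rw [conjTranspose_mul, conjTranspose_conjTranspose, ← hC e f] at h
    simpa using h
  -- Diagonalising the Gram matrix `C` of the errors replaces them by mutually orthogonal ones with
  -- the same span.
  set U : Matrix ι ι ℂ := hherm.eigenvectorUnitary.1 with hU
  have hUU : U * Uᴴ = 1 := Unitary.coe_mul_star_self hherm.eigenvectorUnitary
  have hUU' : Uᴴ * U = 1 := Unitary.coe_star_mul_self hherm.eigenvectorUnitary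
  have hdiag : Uᴴ * Matrix.of C * U = diagonal (fun i => (hherm.eigenvalues i : ℂ)) := by
    have h := hherm.spectral_theorem
    rw [Unitary.conjStarAlgAut_apply] at h
    change Matrix.of C = U * _ * Uᴴ at h
    calc Uᴴ * Matrix.of C * U = Uᴴ * (U * _ * Uᴴ) * U := congrArg (fun X => Uᴴ * X * U) h
      _ = _ := ?_
    rw [← Matrix.mul_assoc, ← Matrix.mul_assoc, hUU', Matrix.one_mul, Matrix.mul_assoc, hUU',
      Matrix.mul_one]
    rfl
  let G : ι → Matrix A B ℂ := fun k => ∑ e, U e k • F e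
  have hFG : ∀ e, F e = ∑ k, star (U e k) • G k := by
    intro e
    simp only [G, Finset.smul_sum, smul_smul]
    rw [Finset.sum_comm]
    simp only [← Finset.sum_smul]
    rw [Finset.sum_eq_single e]
    · have h := congrFun (congrFun hUU e) e
      rw [mul_apply, one_apply_eq] at h
      simp only [conjTranspose_apply] at h
      simp only [mul_comm (star _), h, one_smul]
    · intro f _ hf
      have h := congrFun (congrFun hUU f) e
      rw [mul_apply, one_apply_ne hf] at h
      simp only [conjTranspose_apply] at h
      simp only [mul_comm (star _), h, zero_smul]
    · simp
  have hGG : ∀ k k', (G k)ᴴ * G k' = if k = k' then (hherm.eigenvalues k : ℂ) • 1 else 0 := by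
    intro k k'
    have h := congrFun (congrFun hdiag k) k'
    have h₁ : (G k)ᴴ * G k' = (Uᴴ * Matrix.of C * U) k k' • (1 : Matrix B B ℂ) := by
      simp only [G, conjTranspose_sum, conjTranspose_smul, Matrix.sum_mul, Matrix.mul_sum,
        smul_mul, Matrix.mul_smul, ← hC, mul_apply, conjTranspose_apply, of_apply, smul_smul,
        Finset.sum_smul, Finset.smul_sum, Finset.sum_mul]
      refine Finset.sum_congr rfl fun f _ => Finset.sum_congr rfl fun e _ => ?_
      congr 1
      ring
    rw [h₁, h, diagonal_apply]
    split_ifs <;> simp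
  obtain ⟨Φ, hΦ, h⟩ := exists_recovery_of_orthogonal G _ hGG
  refine ⟨Φ, hΦ, fun H hH => h H (Submodule.span_le.2 ?_ hH)⟩
  rintro _ ⟨e, rfl⟩
  rw [hFG]
  exact Submodule.sum_mem _ fun k _ =>
    Submodule.smul_mem _ _ (Submodule.subset_span (Set.mem_range_self k))

end Channels

/-! ### Operators acting on one qudit. -/

section LocalOperators

variable {d n : ℕ}

theorem sum_of_agree_off (i : Fin n) (x : Fin n → Fin d) (f : (Fin n → Fin d) → ℂ) :
    (∑ y, if ∀ k, k ≠ i → x k = y k then f y else 0) = ∑ s, f (Function.update x i s) := by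
  rw [← Finset.sum_filter]
  symm
  refine Finset.sum_nbij (fun s => Function.update x i s) (fun s _ => ?_) (fun s _ s' _ h => ?_)
    (fun y hy => ?_) fun _ _ => rfl
  · simp only [mem_filter, mem_univ, true_and]
    intro k hk
    rw [Function.update_of_ne hk]
  · simpa using congrFun h i
  · simp only [coe_filter, mem_univ, true_and, Set.mem_ofPred_eq] at hy
    refine ⟨y i, by simp, ?_⟩
    funext k
    by_cases hk : k = i
    · subst hk; simp
    · simp only [Function.update_of_ne hk, hy k hk]

theorem localOp_mul_apply {κ : Type*} (i : Fin n) (U : Matrix (Fin d) (Fin d) ℂ)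
    (M : Matrix (Fin n → Fin d) κ ℂ) (x : Fin n → Fin d) (c : κ) :
    (localOp i U * M) x c = ∑ s, U (x i) s * M (Function.update x i s) c := by
  rw [mul_apply]
  simp only [localOp, of_apply, ite_mul, zero_mul]
  rw [sum_of_agree_off i x fun y => U (x i) (y i) * M y c]
  simp

theorem localOp_one (i : Fin n) : localOp i (1 : Matrix (Fin d) (Fin d) ℂ) = 1 := by
  ext x y
  simp only [localOp, of_apply, one_apply]
  by_cases h : x = y
  · subst h; simp
  · rw [if_neg h]
    split_ifs with h₁ h₂
    · exact absurd (funext fun k => by by_cases hk : k = i; exacts [hk ▸ h₂, h₁ k hk]) h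
    all_goals rfl

theorem localOp_mul (i : Fin n) (U U' : Matrix (Fin d) (Fin d) ℂ) :
    localOp i U * localOp i U' = localOp i (U * U') := by
  ext x y
  rw [localOp_mul_apply]
  simp only [localOp, of_apply, Function.update_self, mul_apply]
  by_cases h : ∀ k, k ≠ i → x k = y k
  · rw [if_pos h]
    refine Finset.sum_congr rfl fun s _ => ?_
    rw [if_pos fun k hk => by rw [Function.update_of_ne hk, h k hk]]
  · rw [if_neg h]
    refine Finset.sum_eq_zero fun s _ => ?_
    rw [if_neg fun h' => h fun k hk => by have := h' k hk; rwa [Function.update_of_ne hk] at this,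
      mul_zero]

theorem localOp_conjTranspose (i : Fin n) (U : Matrix (Fin d) (Fin d) ℂ) :
    (localOp i U)ᴴ = localOp i Uᴴ := by
  ext x y
  simp only [localOp, conjTranspose_apply, of_apply, apply_ite star, star_zero, eq_comm]

/-- `localOp i` as a linear map. -/
def localOpLin (i : Fin n) : Matrix (Fin d) (Fin d) ℂ →ₗ[ℂ] QOp d n where
  toFun := localOp i
  map_add' U U' := by
    ext x y; simp only [localOp, of_apply, Matrix.add_apply]; split_ifs <;> simp only [add_zero]
  map_smul' c U := by
    ext x y; simp only [localOp, of_apply, Matrix.smul_apply, RingHom.id_apply]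
    split_ifs <;> simp only [smul_zero]

theorem localOp_conjTranspose_mul_self {i : Fin n} {U : Matrix (Fin d) (Fin d) ℂ}
    (hU : U ∈ Matrix.unitaryGroup (Fin d) ℂ) : (localOp i U)ᴴ * localOp i U = 1 := by
  rw [localOp_conjTranspose, localOp_mul]
  have : Uᴴ * U = 1 := (Matrix.mem_unitaryGroup_iff').1 hU
  rw [this, localOp_one]

theorem ketbra_mulVec {l u : ℕ} (W : Matrix (Fin n → Fin d) (Fin u → Fin l) ℂ) (μ : QVec l u) :
    ketbra (W *ᵥ μ) = W * ketbra μ * Wᴴ := by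
  unfold ketbra
  rw [mul_vecMulVec, vecMulVec_mul, vecMul_conjTranspose, star_star]

theorem trace_ketbra {μ : QVec d n} (hμ : IsUnitKet μ) : (ketbra μ).trace = 1 := by
  rw [ketbra, trace_vecMulVec, dotProduct_comm]; exact hμ

end LocalOperators

/-! ### From erasure correction to unitary error correction. -/

section Erasure

variable {d n m : ℕ}

/-- The Kraus operators `⟨z|_J ⊗ 1` of the deletion of `J`. -/
def deletionKraus (J : Finset (Fin n)) (h : #Jᶜ = m) (z : {i // i ∈ J} → Fin d) :
    Matrix (Fin m → Fin d) (Fin n → Fin d) ℂ :=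
  Matrix.of fun v x => if (fun i : {i // i ∈ J} => x i.1) = z ∧ subword Jᶜ h x = v then 1 else 0

theorem deletion_eq_sum (J : Finset (Fin n)) (h : #Jᶜ = m) (ρ : QOp d n) :
    deletion J h ρ = ∑ z : {i // i ∈ J} → Fin d, deletionKraus J h z * ρ * (deletionKraus J h z)ᴴ := by
  ext v w
  rw [Matrix.sum_apply]
  simp only [deletion, of_apply, mul_apply, deletionKraus, conjTranspose_apply, Finset.sum_mul,
    apply_ite star, star_one, star_zero]
  have key : ∀ x y : Fin n → Fin d,
      (∑ z : {i // i ∈ J} → Fin d,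
        (if (fun i : {i // i ∈ J} => x i.1) = z ∧ subword Jᶜ h x = v then (1 : ℂ) else 0) * ρ x y *
          if (fun i : {i // i ∈ J} => y i.1) = z ∧ subword Jᶜ h y = w then 1 else 0) =
      if (∀ i ∈ J, x i = y i) ∧ subword Jᶜ h x = v ∧ subword Jᶜ h y = w then ρ x y else 0 := by
    intro x y
    rw [Finset.sum_eq_single (fun i : {i // i ∈ J} => x i.1)]
    · have hiff : ((fun i : {i // i ∈ J} => y i.1) = fun i => x i.1) ↔ ∀ i ∈ J, x i = y i :=
        ⟨fun hc i hi => (congrFun hc ⟨i, hi⟩).symm, fun hc => funext fun i => (hc i.1 i.2).symm⟩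
      simp only [hiff, true_and]
      split_ifs <;> first | (simp; done) | (exfalso; tauto)
    · intro z _ hz
      rw [if_neg fun hc => hz hc.1.symm, zero_mul, zero_mul]
    · simp
  simp only [← key]
  calc _ = ∑ x, ∑ z, ∑ y, _ := Finset.sum_congr rfl fun x _ => Finset.sum_comm
    _ = ∑ z, ∑ x, ∑ y, _ := Finset.sum_comm
    _ = _ := Finset.sum_congr rfl fun z _ => Finset.sum_comm

theorem eq_of_subword {J : Finset (Fin n)} {h : #Jᶜ = m} {x y : Fin n → Fin d}
    (h₁ : (fun i : {i // i ∈ J} => x i.1) = fun i => y i.1) (h₂ : subword Jᶜ h x = subword Jᶜ h y) :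
    x = y := by
  funext k
  by_cases hk : k ∈ J
  · exact congrFun h₁ ⟨k, hk⟩
  · have : k ∈ Set.range (Jᶜ.orderEmbOfFin h) := by
      rw [range_orderEmbOfFin]; simpa using hk
    obtain ⟨j, rfl⟩ := this
    exact congrFun h₂ j

theorem sum_deletionKraus (J : Finset (Fin n)) (h : #Jᶜ = m) :
    ∑ z : {i // i ∈ J} → Fin d, (deletionKraus (d := d) J h z)ᴴ * deletionKraus J h z = 1 := by
  ext x y
  rw [Matrix.sum_apply]
  simp only [mul_apply, deletionKraus, conjTranspose_apply, of_apply, apply_ite star, star_one,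
    star_zero, one_apply]
  rw [Finset.sum_eq_single (fun i : {i // i ∈ J} => x i.1), Finset.sum_eq_single (subword Jᶜ h x)]
  · by_cases hxy : x = y
    · subst hxy; simp
    · rw [if_neg hxy, if_pos ⟨rfl, rfl⟩, if_neg fun hc => hxy (eq_of_subword hc.1 hc.2).symm,
        mul_zero]
  · intro v _ hv
    rw [if_neg fun hc => hv hc.2.symm, zero_mul]
  · simp
  · intro z _ hz
    exact Finset.sum_eq_zero fun v _ => by rw [if_neg fun hc => hz hc.1.symm, zero_mul]
  · simp

/-- An operator on an erased qudit only changes the vector `⟨z|` with which that qudit is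
contracted, so decoders for the erasure of `J` are insensitive to it. -/
theorem deletionKraus_mul_localOp (J : Finset (Fin n)) (h : #Jᶜ = m) (z : {i // i ∈ J} → Fin d)
    (i : {i // i ∈ J}) (X : Matrix (Fin d) (Fin d) ℂ) :
    deletionKraus J h z * localOp i.1 X =
      ∑ s, X (z i) s • deletionKraus J h (Function.update z i s) := by
  have hT : (deletionKraus J h z * localOp i.1 X)ᴴ =
      localOp i.1 Xᴴ * (deletionKraus J h z)ᴴ := by
    rw [conjTranspose_mul, localOp_conjTranspose]
  rw [← conjTranspose_inj, hT]
  ext y v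
  rw [localOp_mul_apply, conjTranspose_apply, Matrix.sum_apply, star_sum]
  have hsub : ∀ s, subword Jᶜ h (Function.update y i.1 s) = subword Jᶜ h y := by
    intro s
    funext k
    refine Function.update_of_ne (fun hc => ?_) _ _
    have := orderEmbOfFin_mem Jᶜ h k
    rw [hc, mem_compl] at this
    exact this i.2
  have hJ : ∀ s, (fun j : {i // i ∈ J} => Function.update y i.1 s j.1) =
      Function.update (fun j : {i // i ∈ J} => y j.1) i s := by
    intro s
    funext j
    by_cases hj : j = i
    · subst hj; simp
    · rw [Function.update_of_ne hj, Function.update_of_ne fun hc => hj (Subtype.ext hc)]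
  have hiff : Function.update (fun j : {i // i ∈ J} => y j.1) i (z i) = z ↔
      (fun j : {i // i ∈ J} => y j.1) = Function.update z i (y i) := by
    constructor
    · intro hc; rw [← hc]; simp
    · intro hc
      conv_lhs => rw [hc]
      simp
  rw [Finset.sum_eq_single (z i), Finset.sum_eq_single (y i.1)]
  · simp only [conjTranspose_apply, deletionKraus, of_apply, Matrix.smul_apply, smul_eq_mul, star_mul',
      hsub, hJ, hiff]
  · intro s _ hs
    simp only [deletionKraus, of_apply, Matrix.smul_apply, smul_eq_mul]
    rw [if_neg fun hc => hs ?_, mul_zero, star_zero]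
    have := congrFun hc.1 i
    simpa using this.symm
  · simp
  · intro s _ hs
    simp only [conjTranspose_apply, deletionKraus, of_apply, hJ]
    rw [if_neg fun hc => hs ?_, star_zero, mul_zero]
    have := congrFun hc.1 i
    simpa using this
  · simp

/-- The errors `F` are the matrix units on single qudits, which span all single-qudit errors. For a
pair of them, inserting the completeness relation of erasure followed by its decoder writes `(F e)ᴴ
* F f` as a sum of products of scalars. -/
theorem exists_unitaryErrorCorrector {l u t : ℕ} (hl : 1 ≤ l) (ht : 2 ≤ t)
    {V : Encoder l u l n} (hV : Vᴴ * V = 1) (hC : IsErasureCorrecting t V) :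
    ∃ Φ : QOp l n →ₗ[ℂ] QOp l u, IsUnitaryErrorCorrector V Φ := by
  have : Nonempty (Fin l) := ⟨⟨0, hl⟩⟩
  let F : (Fin n × Fin l × Fin l) → Encoder l u l n := fun e =>
    localOp e.1 (single e.2.1 e.2.2 1) * V
  have hF : ∀ e f, (F e)ᴴ * F f ∈ Submodule.span ℂ {(1 : QOp l u)} := by
    intro e f
    set J : Finset (Fin n) := {e.1, f.1} with hJ
    have hJt : #J ≤ t := (Finset.card_le_two).trans ht
    obtain ⟨R, ⟨k, K, hK, hR⟩, hRμ⟩ := hC J hJt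
    let D := deletionKraus (d := l) J (card_compl_eq_sub J)
    have hDV : ∀ a z, K a * D z * V ∈ Submodule.span ℂ {(1 : QOp l u)} := by
      intro a z
      refine kraus_mul_mem_span_one (K := fun p : Fin k × ({i // i ∈ J} → Fin l) =>
        K p.1 * D p.2) (fun μ hμ => ?_) (a, z)
      have h := hRμ μ hμ
      rw [hR, deletion_eq_sum] at h
      refine Eq.trans ?_ h
      rw [Fintype.sum_prod_type]
      refine Finset.sum_congr rfl fun a _ => ?_
      rw [Matrix.mul_sum, Matrix.sum_mul]
      refine Finset.sum_congr rfl fun z _ => ?_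
      simp only [conjTranspose_mul, Matrix.mul_assoc, ketbra, D]
    have hDF : ∀ a z e', e'.1 ∈ J → K a * D z * F e' ∈ Submodule.span ℂ {(1 : QOp l u)} := by
      intro a z e' he'
      simp only [F]
      rw [Matrix.mul_assoc, ← Matrix.mul_assoc (D z),
        deletionKraus_mul_localOp J _ z ⟨e'.1, he'⟩, Matrix.sum_mul, Matrix.mul_sum]
      refine Submodule.sum_mem _ fun s _ => ?_
      rw [smul_mul, Matrix.mul_smul, ← Matrix.mul_assoc]
      exact Submodule.smul_mem _ _ (hDV a _)
    have hsum : (F e)ᴴ * F f = ∑ a, ∑ z, (K a * D z * F e)ᴴ * (K a * D z * F f) := by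
      have h₁ : ∑ a, ∑ z, (D z)ᴴ * ((K a)ᴴ * K a) * D z = 1 := by
        rw [Finset.sum_comm]
        simp only [← Matrix.sum_mul, ← Matrix.mul_sum, hK, Matrix.mul_one]
        exact sum_deletionKraus J _
      calc (F e)ᴴ * F f = (F e)ᴴ * (∑ a, ∑ z, (D z)ᴴ * ((K a)ᴴ * K a) * D z) * F f := by
            rw [h₁, Matrix.mul_one]
        _ = _ := by
          simp only [Matrix.mul_sum, Matrix.sum_mul, conjTranspose_mul, Matrix.mul_assoc]
    rw [hsum]
    refine Submodule.sum_mem _ fun a _ => Submodule.sum_mem _ fun z _ => ?_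
    obtain ⟨c, hc⟩ := Submodule.mem_span_singleton.1 (hDF a z e (by simp [hJ]))
    obtain ⟨c', hc'⟩ := Submodule.mem_span_singleton.1 (hDF a z f (by simp [hJ]))
    rw [← hc, ← hc', Submodule.mem_span_singleton]
    exact ⟨star c * c', by simp [smul_smul, mul_comm]⟩
  obtain ⟨Φ, hΦ, h⟩ := exists_recovery F hF
  refine ⟨Φ, hΦ, fun i U hU μ hμ => ?_⟩
  have hG := h (localOp i U * V) ?_ ?_ (ketbra μ)
  · rw [← hG, ketbra_mulVec]
    simp only [conjTranspose_mul, Matrix.mul_assoc]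
  · have : localOp i U = ∑ p, ∑ q, U p q • localOp i (single p q 1) := by
      change localOpLin i U = _
      conv_lhs => rw [matrix_eq_sum_single U]
      simp only [map_sum]
      refine Finset.sum_congr rfl fun p _ => Finset.sum_congr rfl fun q _ => ?_
      have h₁ := map_smul (localOpLin (n := n) i) (U p q) (single p q 1)
      rw [smul_single, smul_eq_mul, mul_one] at h₁
      exact h₁
    rw [this]
    simp only [Matrix.sum_mul, smul_mul]
    exact Submodule.sum_mem _ fun p _ => Submodule.sum_mem _ fun q _ =>
      Submodule.smul_mem _ _ (Submodule.subset_span ⟨(i, p, q), rfl⟩)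
  · rw [conjTranspose_mul, Matrix.mul_assoc, ← Matrix.mul_assoc _ (localOp i U),
      localOp_conjTranspose_mul_self hU, Matrix.one_mul, hV]

end Erasure

/-! ### The ranges of the maps `η` and the projections onto them. -/

section Levels

variable {l t n : ℕ}

/-- The word `k` of maps `η_k` whose ranges contain the basis labels of `x`. -/
def levelWord (x : Fin n → Fin (l * (t + 1))) : Fin n → Fin (t + 1) :=
  fun i => (finProdFinEquiv.symm (x i)).2

/-- The basis labels with the maps `η_k` undone. -/
def baseWord (x : Fin n → Fin (l * (t + 1))) : Fin n → Fin l :=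
  fun i => (finProdFinEquiv.symm (x i)).1

/-- The word `η_{r₁}(z₁) ⋯ η_{rₙ}(zₙ)`. -/
def etaWord (r : Fin n → Fin (t + 1)) (z : Fin n → Fin l) : Fin n → Fin (l * (t + 1)) :=
  fun i => eta (r i) (z i)

theorem levelWord_etaWord (r : Fin n → Fin (t + 1)) (z : Fin n → Fin l) :
    levelWord (etaWord r z) = r := by
  funext i; simp [levelWord, etaWord, eta]

theorem baseWord_etaWord (r : Fin n → Fin (t + 1)) (z : Fin n → Fin l) :
    baseWord (etaWord r z) = z := by
  funext i; simp [baseWord, etaWord, eta]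

theorem etaWord_level_base (x : Fin n → Fin (l * (t + 1))) :
    etaWord (levelWord x) (baseWord x) = x := by
  funext i; exact finProdFinEquiv.apply_symm_apply (x i)

theorem eq_etaWord_iff {r : Fin n → Fin (t + 1)} {z : Fin n → Fin l}
    {x : Fin n → Fin (l * (t + 1))} : x = etaWord r z ↔ levelWord x = r ∧ baseWord x = z := by
  constructor
  · rintro rfl; exact ⟨levelWord_etaWord r z, baseWord_etaWord r z⟩
  · rintro ⟨rfl, rfl⟩; exact (etaWord_level_base x).symm

theorem sum_ite_levelWord (r : Fin n → Fin (t + 1)) (f : (Fin n → Fin (l * (t + 1))) → ℂ) :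
    (∑ x, if levelWord x = r then f x else 0) = ∑ z, f (etaWord r z) := by
  rw [← Finset.sum_filter]
  symm
  refine Finset.sum_nbij' (etaWord r) baseWord (fun z _ => ?_) (fun x _ => mem_univ _)
    (fun z _ => baseWord_etaWord r z) (fun x hx => ?_) fun _ _ => rfl
  · simp [levelWord_etaWord]
  · obtain rfl : levelWord x = r := by simpa using hx
    exact etaWord_level_base x

theorem etaIso_apply (r : Fin n → Fin (t + 1)) (x : Fin n → Fin (l * (t + 1)))
    (z : Fin n → Fin l) : etaIso l r x z = if x = etaWord r z then 1 else 0 := rfl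

theorem etaIso_mul_apply {κ : Type*} (r : Fin n → Fin (t + 1)) (M : Matrix (Fin n → Fin l) κ ℂ)
    (x : Fin n → Fin (l * (t + 1))) (c : κ) :
    (etaIso l r * M) x c = if levelWord x = r then M (baseWord x) c else 0 := by
  rw [mul_apply]
  simp only [etaIso_apply, eq_etaWord_iff, ite_and, ite_mul, one_mul, zero_mul]
  split_ifs <;> simp

theorem conjTranspose_etaIso_mul_apply {κ : Type*} (r : Fin n → Fin (t + 1))
    (M : Matrix (Fin n → Fin (l * (t + 1))) κ ℂ) (z : Fin n → Fin l) (c : κ) :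
    ((etaIso l r)ᴴ * M) z c = M (etaWord r z) c := by
  rw [mul_apply]
  simp [etaIso_apply, conjTranspose_apply, apply_ite star]

theorem mul_etaIso_apply {κ : Type*} (r : Fin n → Fin (t + 1))
    (M : Matrix κ (Fin n → Fin (l * (t + 1))) ℂ) (z : Fin n → Fin l) (c : κ) :
    (M * etaIso l r) c z = M c (etaWord r z) := by
  rw [mul_apply]
  simp [etaIso_apply]

theorem mul_conjTranspose_etaIso_apply {κ : Type*} (r : Fin n → Fin (t + 1))
    (M : Matrix κ (Fin n → Fin l) ℂ) (x : Fin n → Fin (l * (t + 1))) (c : κ) :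
    (M * (etaIso l r)ᴴ) c x = if levelWord x = r then M c (baseWord x) else 0 := by
  rw [mul_apply]
  simp only [conjTranspose_apply, etaIso_apply, eq_etaWord_iff, ite_and, apply_ite star, star_one,
    star_zero, mul_ite, mul_one, mul_zero]
  split_ifs <;> simp

theorem etaIso_conj_apply (r : Fin n → Fin (t + 1)) (κ : QOp l n)
    (x y : Fin n → Fin (l * (t + 1))) :
    (etaIso l r * κ * (etaIso l r)ᴴ) x y =
      if levelWord x = r ∧ levelWord y = r then κ (baseWord x) (baseWord y) else 0 := by
  rw [mul_conjTranspose_etaIso_apply, etaIso_mul_apply, ite_and]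
  split_ifs <;> rfl

theorem conjTranspose_etaIso_mul_etaIso (r r' : Fin n → Fin (t + 1)) :
    (etaIso l r)ᴴ * etaIso l r' = if r = r' then 1 else 0 := by
  ext z z'
  simp only [conjTranspose_etaIso_mul_apply, etaIso_apply, eq_etaWord_iff, levelWord_etaWord,
    baseWord_etaWord]
  by_cases h : r = r'
  · simp [h, one_apply]
  · simp [h]

theorem sum_etaIso_mul_conjTranspose :
    ∑ r : Fin n → Fin (t + 1), etaIso l r * (etaIso l r)ᴴ = 1 := by
  ext x y
  rw [Matrix.sum_apply]
  simp only [mul_conjTranspose_etaIso_apply, etaIso_apply, one_apply]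
  rw [Finset.sum_ite_eq univ (levelWord y), if_pos (mem_univ _), etaWord_level_base]

theorem subword_etaWord {m : ℕ} (K : Finset (Fin n)) (h : #K = m) (r : Fin n → Fin (t + 1))
    (z : Fin n → Fin l) : subword K h (etaWord r z) = etaWord (subword K h r) (subword K h z) := rfl

/-- Deletion commutes with the maps `η`. -/
theorem deletion_etaIso_conj {m : ℕ} (J : Finset (Fin n)) (h : #Jᶜ = m) (r : Fin n → Fin (t + 1))
    (κ : QOp l n) : deletion J h (etaIso l r * κ * (etaIso l r)ᴴ) =
      etaIso l (subword Jᶜ h r) * deletion J h κ * (etaIso l (subword Jᶜ h r))ᴴ := by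
  ext v w
  rw [etaIso_conj_apply]
  simp only [deletion, of_apply, etaIso_conj_apply]
  have h₁ : ∀ x y : Fin n → Fin (l * (t + 1)),
      (if (∀ i ∈ J, x i = y i) ∧ subword Jᶜ h x = v ∧ subword Jᶜ h y = w then
        (if levelWord x = r ∧ levelWord y = r then κ (baseWord x) (baseWord y) else 0) else 0) =
      if levelWord x = r then (if levelWord y = r then
        (if (∀ i ∈ J, x i = y i) ∧ subword Jᶜ h x = v ∧ subword Jᶜ h y = w then
          κ (baseWord x) (baseWord y) else 0) else 0) else 0 := by
    intro x y
    split_ifs <;> first | rfl | (exfalso; tauto)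
  simp only [h₁, Finset.sum_ite_irrel, Finset.sum_const_zero]
  rw [sum_ite_levelWord r fun x => ∑ y, if levelWord y = r then
        (if (∀ i ∈ J, x i = y i) ∧ subword Jᶜ h x = v ∧ subword Jᶜ h y = w then
          κ (baseWord x) (baseWord y) else 0) else 0]
  simp only [sum_ite_levelWord]
  have hJ : ∀ z z' : Fin n → Fin l,
      (∀ i ∈ J, etaWord r z i = etaWord r z' i) ↔ ∀ i ∈ J, z i = z' i := by
    intro z z'
    refine forall₂_congr fun i _ => ⟨fun hc => ?_, fun hc => by simp only [etaWord, hc]⟩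
    exact (Prod.ext_iff.1 (finProdFinEquiv.injective hc)).1
  have hsub : ∀ (z : Fin n → Fin l) (v : Fin m → Fin (l * (t + 1))),
      subword Jᶜ h (etaWord r z) = v ↔
        levelWord v = subword Jᶜ h r ∧ subword Jᶜ h z = baseWord v := by
    intro z v
    rw [subword_etaWord, eq_comm, eq_etaWord_iff, eq_comm (a := baseWord v)]
  simp only [hJ, hsub, baseWord_etaWord]
  by_cases hc : levelWord v = subword Jᶜ h r ∧ levelWord w = subword Jᶜ h r
  · simp only [hc, and_self, if_true, true_and]
  · rw [if_neg hc]
    refine Finset.sum_eq_zero fun z _ => Finset.sum_eq_zero fun z' _ => if_neg fun hc' => hc ?_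
    exact ⟨hc'.2.1.1, hc'.2.2.1⟩

theorem etaIso_isometry (r : Fin n → Fin (t + 1)) : (etaIso l r)ᴴ * etaIso l r = 1 := by
  rw [conjTranspose_etaIso_mul_etaIso, if_pos rfl]

theorem measProj_apply (k : Fin (t + 1)) (x y : Fin (l * (t + 1))) :
    measProj l k x y = if x = y ∧ (finProdFinEquiv.symm x).2 = k then 1 else 0 := by
  have hx : ∀ j : Fin l, x = eta k j ↔
      (finProdFinEquiv.symm x).2 = k ∧ (finProdFinEquiv.symm x).1 = j := by
    intro j
    rw [eta, ← Equiv.symm_apply_eq, Prod.ext_iff, and_comm]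
  simp only [measProj, Matrix.sum_apply, vecMulVec_apply, Pi.star_apply, Pi.single_apply,
    apply_ite star, star_one, star_zero, mul_ite, mul_one, mul_zero, ← ite_and]
  by_cases h : x = y ∧ (finProdFinEquiv.symm x).2 = k
  · obtain ⟨rfl, hk⟩ := h
    simp only [hx, hk, true_and, and_self, Finset.sum_ite_eq, mem_univ, if_true]
  · rw [if_neg h]
    refine Finset.sum_eq_zero fun j _ => if_neg fun hc => h ⟨hc.2.trans hc.1.symm, ?_⟩
    exact ((hx j).1 hc.2).1

theorem measProjSeq_apply (r : Fin n → Fin (t + 1)) (x y : Fin n → Fin (l * (t + 1))) :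
    measProjSeq l r x y = if x = y ∧ levelWord x = r then 1 else 0 := by
  simp only [measProjSeq, of_apply, measProj_apply, Finset.prod_ite_zero, Finset.prod_const_one,
    mem_univ, true_implies, forall_and, funext_iff, levelWord]

theorem measProjSeq_eq (r : Fin n → Fin (t + 1)) :
    measProjSeq l r = etaIso l r * (etaIso l r)ᴴ := by
  ext x y
  rw [measProjSeq_apply, mul_conjTranspose_etaIso_apply]
  simp only [etaIso_apply, eq_etaWord_iff]
  by_cases hxy : x = y
  · subst hxy; simp
  · rw [if_neg fun hc => hxy hc.1]
    split_ifs with h₁ h₂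
    · refine absurd ?_ hxy
      rw [← etaWord_level_base x, ← etaWord_level_base y, h₁, h₂.1, h₂.2]
    all_goals rfl

end Levels

/-! ### From erasure correction to deletion correction. -/

section DeletionCorrector

/-- A measurement with operators `E s` followed by a channel chosen according to the outcome `s`. -/
theorem exists_isChannel_sum {A A' B ι : Type*} [Fintype A] [DecidableEq A] [Fintype A']
    [DecidableEq A'] [Fintype B] [DecidableEq B] [Fintype ι]
    {R : ι → Matrix A' A' ℂ →ₗ[ℂ] Matrix B B ℂ} (hR : ∀ s, IsChannel (R s))
    (E : ι → Matrix A' A ℂ) (hE : ∑ s, (E s)ᴴ * E s = 1) :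
    ∃ Φ : Matrix A A ℂ →ₗ[ℂ] Matrix B B ℂ, IsChannel Φ ∧
      ∀ ρ, Φ ρ = ∑ s, R s (E s * ρ * (E s)ᴴ) := by
  choose k K hK hRK using hR
  refine ⟨krausMap fun p : (Σ s, Fin (k s)) => K p.1 p.2 * E p.1, isChannel_krausMap ?_,
    fun ρ => ?_⟩
  · rw [Fintype.sum_sigma, ← hE]
    refine Finset.sum_congr rfl fun s _ => ?_
    calc _ = ∑ a, (E s)ᴴ * ((K s a)ᴴ * K s a) * E s := by
          simp only [conjTranspose_mul, Matrix.mul_assoc]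
      _ = _ := by rw [← Matrix.sum_mul, ← Matrix.mul_sum, hK, Matrix.mul_one]
  · rw [krausMap_apply, Fintype.sum_sigma]
    refine Finset.sum_congr rfl fun s _ => ?_
    rw [hRK]
    simp only [conjTranspose_mul, Matrix.mul_assoc]

theorem le_val_of_strictMono {m n : ℕ} {f : Fin m → Fin n} (hf : StrictMono f) (k : Fin m) :
    k.val ≤ (f k).val := by
  obtain ⟨k, hk⟩ := k
  induction k with
  | zero => exact Nat.zero_le _
  | succ k ih =>
    have h₁ := ih (by omega)
    have h₂ : f ⟨k, by omega⟩ < f ⟨k + 1, hk⟩ := hf (by simp [Fin.lt_def])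
    rw [Fin.lt_def] at h₂
    simp only at h₁ ⊢
    omega

theorem val_add_le_of_strictMono {m n : ℕ} {f : Fin m → Fin n} (hf : StrictMono f) (k : Fin m) :
    (f k).val + m ≤ k.val + n := by
  obtain ⟨d, hd⟩ : ∃ d, k.val + d + 1 = m := ⟨m - k.val - 1, by omega⟩
  induction d generalizing k with
  | zero => omega
  | succ d ih =>
    have h₁ := ih ⟨k.val + 1, by omega⟩ (by simp only; omega)
    have h₂ : f k < f ⟨k.val + 1, by omega⟩ := hf (by simp [Fin.lt_def])
    rw [Fin.lt_def] at h₂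
    simp only at h₁
    omega

/-- At most `t` deletions from the periodic sequence can be located from the resulting word. -/
theorem eq_of_subword_periodicSeq {n m t : ℕ} {J J' : Finset (Fin n)} {h : #Jᶜ = m}
    {h' : #J'ᶜ = m} (hJ : #J ≤ t)
    (hs : subword Jᶜ h (periodicSeq n t) = subword J'ᶜ h' (periodicSeq n t)) : J = J' := by
  have hn : n ≤ m + t := by rw [card_compl_eq_sub] at h; omega
  -- The `k`th survivor sits between `k` and `k + (n - m)`, a window of at most `t + 1` positions,
  -- on which residues modulo `t + 1` are distinct.
  have hmod : ∀ a b k : ℕ, k ≤ a → a + m ≤ k + n → k ≤ b → b + m ≤ k + n → a ≤ b →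
      a % (t + 1) = b % (t + 1) → a = b := by
    intro a b k _ _ _ _ hab h
    by_contra hne
    have := Nat.le_of_dvd (by omega) ((Nat.modEq_iff_dvd' hab).1 h)
    omega
  have heq : (Jᶜ.orderEmbOfFin h : Fin m → Fin n) = J'ᶜ.orderEmbOfFin h' := by
    funext k
    have h₁ := le_val_of_strictMono (Jᶜ.orderEmbOfFin h).strictMono k
    have h₂ := val_add_le_of_strictMono (Jᶜ.orderEmbOfFin h).strictMono k
    have h₃ := le_val_of_strictMono (J'ᶜ.orderEmbOfFin h').strictMono k
    have h₄ := val_add_le_of_strictMono (J'ᶜ.orderEmbOfFin h').strictMono k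
    have h₅ : (Jᶜ.orderEmbOfFin h k).val % (t + 1) = (J'ᶜ.orderEmbOfFin h' k).val % (t + 1) :=
      congrArg Fin.val (congrFun hs k)
    rcases le_total (Jᶜ.orderEmbOfFin h k).val (J'ᶜ.orderEmbOfFin h' k).val with hle | hle
    · exact Fin.ext (hmod _ _ _ h₁ h₂ h₃ h₄ hle h₅)
    · exact Fin.ext (hmod _ _ _ h₃ h₄ h₁ h₂ hle h₅.symm).symm
  have := congrArg Set.range heq
  rw [range_orderEmbOfFin, range_orderEmbOfFin] at this
  exact compl_injective (Finset.coe_injective this)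

theorem ketbra_delEncoder {l u n t : ℕ} (V : Encoder l u l n) (μ : QVec l u) :
    ketbra (delEncoder t V *ᵥ μ) = etaIso l (periodicSeq n t) * ketbra (V *ᵥ μ) *
      (etaIso l (periodicSeq n t))ᴴ := by
  rw [delEncoder, ← mulVec_mulVec]
  unfold ketbra
  rw [mul_vecMulVec, vecMulVec_mul, vecMul_conjTranspose, star_star]

/-- Measuring the symbols of the received qudits reveals the deleted set without disturbing the
state; undo `η` and use the erasure decoder for that set. Words that cannot occur get an arbitrary
channel. -/
theorem exists_deletionCorrector {l u n t : ℕ} (hl : 1 ≤ l) {V : Encoder l u l n}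
    (hC : IsErasureCorrecting t V) :
    ∃ Δ : (m : ℕ) → QOp (l * (t + 1)) m →ₗ[ℂ] QOp l u,
      IsDeletionCorrector t (delEncoder t V) Δ := by
  have : Nonempty (Fin l) := ⟨⟨0, hl⟩⟩
  have hR : ∀ (m : ℕ) (s : Fin m → Fin (t + 1)), ∃ R : QOp l m →ₗ[ℂ] QOp l u, IsChannel R ∧
      ∀ (J : Finset (Fin n)) (h : #Jᶜ = m), #J ≤ t → subword Jᶜ h (periodicSeq n t) = s →
        ∀ μ : QVec l u, IsUnitKet μ → R (deletion J h (ketbra (V *ᵥ μ))) = ketbra μ := by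
    intro m s
    by_cases hex : ∃ (J : Finset (Fin n)) (h : #Jᶜ = m), #J ≤ t ∧
        subword Jᶜ h (periodicSeq n t) = s
    · obtain ⟨J, h, hJ, hs⟩ := hex
      obtain rfl : n - #J = m := by rw [← h, card_compl_eq_sub]
      obtain ⟨R, hR, hμ⟩ := hC J hJ
      refine ⟨R, hR, fun J' h' hJ' hs' μ hμu => ?_⟩
      obtain rfl := eq_of_subword_periodicSeq hJ (hs.trans hs'.symm)
      exact hμ μ hμu
    · obtain ⟨R, hR⟩ := exists_isChannel (A := Fin m → Fin l) (B := Fin u → Fin l)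
      exact ⟨R, hR, fun J h hJ hs => absurd ⟨J, h, hJ, hs⟩ hex⟩
  choose R hRch hRμ using hR
  have hΔ := fun m => exists_isChannel_sum (hRch m) (fun s => (etaIso l s)ᴴ) (by
    simp only [conjTranspose_conjTranspose]
    exact sum_etaIso_mul_conjTranspose)
  choose Δ hΔch hΔ using hΔ
  refine ⟨Δ, hΔch, fun J hJ μ hμ => ?_⟩
  rw [hΔ, ketbra_delEncoder, deletion_etaIso_conj]
  set s₀ := subword Jᶜ (card_compl_eq_sub J) (periodicSeq n t) with hs₀
  rw [Finset.sum_eq_single s₀]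
  · simp only [conjTranspose_conjTranspose]
    rw [show ∀ X : QOp l (n - #J), (etaIso l s₀)ᴴ * (etaIso l s₀ * X * (etaIso l s₀)ᴴ) *
        etaIso l s₀ = (etaIso l s₀)ᴴ * etaIso l s₀ * X * ((etaIso l s₀)ᴴ * etaIso l s₀) from
        fun X => by simp only [Matrix.mul_assoc], etaIso_isometry, Matrix.one_mul, Matrix.mul_one]
    exact hRμ _ s₀ J _ hJ hs₀.symm μ hμ
  · intro s _ hs
    simp only [Matrix.mul_assoc]
    rw [← Matrix.mul_assoc _ (etaIso l s₀), conjTranspose_etaIso_mul_etaIso, if_neg hs,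
      Matrix.zero_mul, map_zero]
  · simp

end DeletionCorrector

/-! ### Inserting and deleting single qudits. -/

section SingleQudits

variable {d n m : ℕ}

/-- Partial trace onto the qudits `f 0, f 1, …`. -/
def partialTrace (f : Fin m → Fin n) (ρ : QOp d n) : QOp d m :=
  Matrix.of fun v w => ∑ x : Fin n → Fin d, ∑ y : Fin n → Fin d,
    if (∀ i, (∀ k, f k ≠ i) → x i = y i) ∧ x ∘ f = v ∧ y ∘ f = w then ρ x y else 0

/-- Partial trace over the qudit `b`. -/
def removeQudit (b : Fin (n + 1)) (ρ : QOp d (n + 1)) : QOp d n :=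
  Matrix.of fun v w => ∑ s, ρ (b.insertNth s v) (b.insertNth s w)

/-- The product `P ⊗ κ` with the qudit of `P` at position `a`. -/
def insertQudit (a : Fin (n + 1)) (P : Matrix (Fin d) (Fin d) ℂ) (κ : QOp d n) : QOp d (n + 1) :=
  Matrix.of fun x y => P (x a) (y a) * κ (x ∘ a.succAbove) (y ∘ a.succAbove)

theorem deletion_eq_partialTrace (J : Finset (Fin n)) (h : #Jᶜ = m) (ρ : QOp d n) :
    deletion J h ρ = partialTrace (Jᶜ.orderEmbOfFin h) ρ := by
  ext v w
  simp only [deletion, partialTrace, of_apply]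
  have hJ : ∀ i, (∀ k, Jᶜ.orderEmbOfFin h k ≠ i) ↔ i ∈ J := by
    intro i
    have : i ∈ Set.range (Jᶜ.orderEmbOfFin h) ↔ i ∉ J := by
      rw [range_orderEmbOfFin]; simp
    rw [← not_iff_not, ← this]
    simp only [not_forall, not_not, Set.mem_range]
  simp only [hJ]
  rfl

theorem partialTrace_eq_deletion {f : Fin m → Fin n} (hf : StrictMono f) (ρ : QOp d n) :
    ∃ (J : Finset (Fin n)) (h : #Jᶜ = m), partialTrace f ρ = deletion J h ρ := by
  have h : #((univ.image f)ᶜ)ᶜ = m := by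
    rw [compl_compl, card_image_of_injective _ hf.injective, card_univ, Fintype.card_fin]
  refine ⟨_, h, ?_⟩
  rw [deletion_eq_partialTrace]
  congr 1
  exact orderEmbOfFin_unique h (fun k => by simp) hf

theorem sum_insertNth (b : Fin (n + 1)) (F : (Fin (n + 1) → Fin d) → ℂ) :
    ∑ x, F x = ∑ s, ∑ x' : Fin n → Fin d, F (b.insertNth s x') := by
  rw [← Fintype.sum_prod_type' (f := fun s (x' : Fin n → Fin d) => F (b.insertNth s x'))]
  exact (Equiv.sum_comp (Fin.insertNthEquiv (fun _ => Fin d) b) F).symm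

/-- Indexing partial traces by maps rather than sets turns successive deletions into composition of
maps. -/
theorem partialTrace_succAbove_comp (b : Fin (n + 1)) (g : Fin m → Fin n) (ρ : QOp d (n + 1)) :
    partialTrace (b.succAbove ∘ g) ρ = partialTrace g (removeQudit b ρ) := by
  ext v w
  simp only [partialTrace, removeQudit, of_apply]
  rw [sum_insertNth b]
  simp only [sum_insertNth b (fun y => ite _ (ρ _ y) _)]
  have hiff : ∀ (s s' : Fin d) (x y : Fin n → Fin d),
      (∀ i, (∀ k, (b.succAbove ∘ g) k ≠ i) → (b.insertNth s x : Fin (n + 1) → Fin d) i =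
        (b.insertNth s' y : Fin (n + 1) → Fin d) i) ↔
      s = s' ∧ ∀ i, (∀ k, g k ≠ i) → x i = y i := by
    intro s s' x y
    constructor
    · refine fun h => ⟨?_, fun i hi => ?_⟩
      · simpa using h b fun k => Fin.succAbove_ne b _
      · simpa using h (b.succAbove i) fun k hk => hi k (Fin.succAbove_right_injective hk)
    · rintro ⟨rfl, h⟩ i hi
      rcases Fin.eq_self_or_eq_succAbove b i with rfl | ⟨j, rfl⟩
      · simp
      · simpa using h j fun k hk => hi k (congrArg b.succAbove hk)
  have hcomp : ∀ (s : Fin d) (x : Fin n → Fin d),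
      (b.insertNth s x : Fin (n + 1) → Fin d) ∘ b.succAbove ∘ g = x ∘ g := by
    intro s x; funext k; simp
  simp only [hiff, hcomp]
  rw [Finset.sum_comm]
  refine Finset.sum_congr rfl fun x _ => ?_
  calc _ = ∑ s, ∑ y : Fin n → Fin d,
        if (∀ i, (∀ k, g k ≠ i) → x i = y i) ∧ x ∘ g = v ∧ y ∘ g = w then
          ρ (b.insertNth s x) (b.insertNth s y) else 0 := by
        refine Finset.sum_congr rfl fun s _ => ?_
        rw [Finset.sum_eq_single s]
        · simp only [true_and]
        · intro s' _ hs'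
          exact Finset.sum_eq_zero fun y _ => if_neg fun hc => hs' hc.1.1.symm
        · simp
    _ = _ := by
        rw [Finset.sum_comm]
        refine Finset.sum_congr rfl fun y _ => ?_
        split_ifs <;> simp

theorem partialTrace_id (ρ : QOp d n) : partialTrace id ρ = ρ := by
  ext v w
  simp only [partialTrace, of_apply]
  have : ∀ x y : Fin n → Fin d, (∀ i, (∀ k, id k ≠ i) → x i = y i) ↔ True := fun x y =>
    iff_true_intro fun i hi => absurd rfl (hi i)
  simp only [this, true_and, Function.comp_id, ite_and, Finset.sum_ite_irrel,
    Finset.sum_const_zero, Finset.sum_ite_eq', mem_univ, if_true]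

theorem orderEmbOfFin_singleton_compl (b : Fin (n + 1)) (h : #({b} : Finset (Fin (n + 1)))ᶜ = n) :
    (({b} : Finset (Fin (n + 1)))ᶜ.orderEmbOfFin h : Fin n → Fin (n + 1)) = b.succAbove :=
  (orderEmbOfFin_unique h (fun k => by simp) (Fin.strictMono_succAbove b)).symm

theorem deletion_singleton (b : Fin (n + 1)) (h : #({b} : Finset (Fin (n + 1)))ᶜ = n)
    (ρ : QOp d (n + 1)) : deletion {b} h ρ = removeQudit b ρ := by
  rw [deletion_eq_partialTrace, orderEmbOfFin_singleton_compl, ← Function.comp_id b.succAbove,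
    partialTrace_succAbove_comp, partialTrace_id]

theorem insertion_singleton (a : Fin (n + 1)) (h : #({a} : Finset (Fin (n + 1))) = 1)
    (π : QOp d 1) (ρ : QOp d n) :
    insertion {a} h π ρ =
      insertQudit a (Matrix.of fun p q => π (fun _ => p) (fun _ => q)) ρ := by
  ext x y
  have h₁ : ∀ x : Fin (n + 1) → Fin d, subword {a} h x = fun _ => x a := fun x => funext fun k => by
    rw [subword, orderEmbOfFin_singleton]
  have h₂ : ∀ x : Fin (n + 1) → Fin d,
      subword ({a} : Finset (Fin (n + 1)))ᶜ (card_compl_of_card h) x = x ∘ a.succAbove := fun x => by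
    rw [← orderEmbOfFin_singleton_compl a (card_compl_of_card h)]; rfl
  simp only [insertion, insertQudit, of_apply, h₁, h₂]

theorem removeQudit_insertQudit (a : Fin (n + 1)) (P : Matrix (Fin d) (Fin d) ℂ) (κ : QOp d n) :
    removeQudit a (insertQudit a P κ) = P.trace • κ := by
  ext v w
  have h : ∀ (s : Fin d) (v : Fin n → Fin d),
      (a.insertNth s v : Fin (n + 1) → Fin d) ∘ a.succAbove = v := fun s v => by funext k; simp
  simp [removeQudit, insertQudit, h, trace, Finset.sum_mul]

theorem trace_removeQudit (b : Fin (n + 1)) (ρ : QOp d (n + 1)) :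
    (removeQudit b ρ).trace = ρ.trace := by
  simp only [trace, diag_apply, removeQudit, of_apply]
  rw [sum_insertNth b, Finset.sum_comm]

theorem trace_insertQudit (a : Fin (n + 1)) (P : Matrix (Fin d) (Fin d) ℂ) (κ : QOp d n) :
    (insertQudit a P κ).trace = P.trace * κ.trace := by
  rw [← trace_removeQudit a, removeQudit_insertQudit, trace_smul, smul_eq_mul]

/-- Deleting one qudit commutes with inserting another one. -/
theorem removeQudit_insertQudit_succAbove (b : Fin (n + 2)) (a : Fin (n + 1))
    (P : Matrix (Fin d) (Fin d) ℂ) (κ : QOp d (n + 1)) :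
    removeQudit b (insertQudit (b.succAbove a) P κ) =
      insertQudit a P (removeQudit (a.predAbove b) κ) := by
  ext v w
  -- `a.predAbove b` is the position of the deleted qudit among the original ones, the inserted
  -- qudit being disregarded.
  have h : ∀ (s : Fin d) (v : Fin (n + 1) → Fin d),
      (b.insertNth s v : Fin (n + 2) → Fin d) ∘ (b.succAbove a).succAbove =
        (a.predAbove b).insertNth s (v ∘ a.succAbove) := by
    intro s v
    rw [Fin.eq_insertNth_iff]
    constructor
    · simp [Fin.succAbove_succAbove_predAbove]
    · funext k
      simp [Fin.removeNth, Fin.succAbove_succAbove_succAbove_predAbove]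
  simp only [removeQudit, insertQudit, of_apply, h, Fin.insertNth_apply_succAbove]
  rw [← Finset.mul_sum]

theorem trace_one_qudit (π : QOp d 1) :
    (Matrix.of fun p q => π (fun _ => p) (fun _ => q) : Matrix (Fin d) (Fin d) ℂ).trace =
      π.trace := by
  simp only [trace, diag_apply, of_apply]
  exact Equiv.sum_comp (Equiv.funUnique (Fin 1) (Fin d)).symm fun x => π x x

theorem exists_of_mem_indelSet_one {ρ ρ' : QOp d n} (h : ρ' ∈ indelSet 1 ρ) :
    ∃ (a b : Fin (n + 1)) (P : Matrix (Fin d) (Fin d) ℂ), P.trace = 1 ∧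
      ρ' = removeQudit b (insertQudit a P ρ) := by
  obtain ⟨J₁, J₂, h₁, h₂, π, hπ, rfl⟩ := h
  obtain ⟨b, rfl⟩ := card_eq_one.1 h₁
  obtain ⟨a, rfl⟩ := card_eq_one.1 h₂
  exact ⟨a, b, _, (trace_one_qudit π).trans hπ.2, by rw [deletion_singleton, insertion_singleton]⟩

theorem eq_of_mem_indelSet_one_zero {ρ ρ' : QOp d 0} (h : ρ' ∈ indelSet 1 ρ) : ρ' = ρ := by
  obtain ⟨a, b, P, hP, rfl⟩ := exists_of_mem_indelSet_one h
  rw [Subsingleton.elim (α := Fin 1) b a, removeQudit_insertQudit, hP, one_smul]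

/-- One insertion and one deletion either cancel or amount to one deletion followed by one
insertion. -/
theorem eq_or_exists_of_mem_indelSet_one {ρ ρ' : QOp d (n + 1)} (h : ρ' ∈ indelSet 1 ρ) :
    ρ' = ρ ∨ ∃ (a b : Fin (n + 1)) (P : Matrix (Fin d) (Fin d) ℂ),
      ρ' = insertQudit a P (removeQudit b ρ) := by
  obtain ⟨a, b, P, hP, rfl⟩ := exists_of_mem_indelSet_one h
  rcases Fin.eq_self_or_eq_succAbove b a with rfl | ⟨j, rfl⟩
  · left; rw [removeQudit_insertQudit, hP, one_smul]
  · right; exact ⟨j, _, P, removeQudit_insertQudit_succAbove b j P ρ⟩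

/-- Deleting the inserted qudit, and possibly others, leaves the original state with some qudits
deleted. -/
theorem deletion_insertQudit {a b : Fin (n + 1)} {P : Matrix (Fin d) (Fin d) ℂ} (hP : P.trace = 1)
    (ρ : QOp d (n + 1)) {S : Finset (Fin (n + 1))} (h : #Sᶜ = m) (ha : a ∈ S) :
    ∃ (J : Finset (Fin (n + 1))) (h' : #Jᶜ = m),
      deletion S h (insertQudit a P (removeQudit b ρ)) = deletion J h' ρ := by
  have hne : ∀ k, Sᶜ.orderEmbOfFin h k ≠ a := by
    intro k hk
    have := orderEmbOfFin_mem Sᶜ h k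
    rw [hk, mem_compl] at this
    exact this ha
  -- The surviving positions avoid `a`, so their enumeration factors through `a.succAbove`; the
  -- inserted qudit is traced out first and contributes the factor `P.trace = 1`.
  choose g hg using fun k => Fin.exists_succAbove_eq (hne k)
  have hcomp : (Sᶜ.orderEmbOfFin h : Fin m → Fin (n + 1)) = a.succAbove ∘ g :=
    funext fun k => (hg k).symm
  have hmono : StrictMono g := by
    intro i j hij
    have := (Sᶜ.orderEmbOfFin h).strictMono hij
    rwa [← hg, ← hg, (Fin.strictMono_succAbove a).lt_iff_lt] at this
  obtain ⟨J, h', hJ⟩ := partialTrace_eq_deletion ((Fin.strictMono_succAbove b).comp hmono) ρ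
  refine ⟨J, h', ?_⟩
  rw [← hJ, partialTrace_succAbove_comp, deletion_eq_partialTrace, hcomp,
    partialTrace_succAbove_comp, removeQudit_insertQudit, hP, one_smul]

end SingleQudits

/-! ### Effect of the measurement on received states. -/

section Measurement

variable {l t n : ℕ}

theorem measProjSeq_conj_apply (r : Fin n → Fin (t + 1)) (ρ : QOp (l * (t + 1)) n)
    (x y : Fin n → Fin (l * (t + 1))) :
    (measProjSeq l r * ρ * (measProjSeq l r)ᴴ) x y =
      if levelWord x = r ∧ levelWord y = r then ρ x y else 0 := by
  have h : measProjSeq l r * ρ * (measProjSeq l r)ᴴ =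
      etaIso l r * ((etaIso l r)ᴴ * ρ * etaIso l r) * (etaIso l r)ᴴ := by
    rw [measProjSeq_eq]
    simp only [conjTranspose_mul, conjTranspose_conjTranspose, Matrix.mul_assoc]
  rw [h, etaIso_conj_apply, mul_etaIso_apply, conjTranspose_etaIso_mul_apply]
  split_ifs with hc
  · rw [← hc.1, etaWord_level_base, hc.1, ← hc.2, etaWord_level_base]
  · rfl

theorem measProjSeq_mul_self (r : Fin n → Fin (t + 1)) :
    measProjSeq l r * measProjSeq l r = measProjSeq l r := by
  rw [measProjSeq_eq, Matrix.mul_assoc, ← Matrix.mul_assoc (etaIso l r)ᴴ, etaIso_isometry,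
    Matrix.one_mul]

theorem conjTranspose_measProjSeq (r : Fin n → Fin (t + 1)) :
    (measProjSeq l r)ᴴ = measProjSeq l r := by
  rw [measProjSeq_eq, conjTranspose_mul, conjTranspose_conjTranspose]

theorem resultProb_eq_trace (r : Fin n → Fin (t + 1)) (ρ : QOp (l * (t + 1)) n) :
    resultProb r ρ = (measProjSeq l r * ρ * (measProjSeq l r)ᴴ).trace := by
  rw [trace_mul_comm, ← Matrix.mul_assoc, conjTranspose_measProjSeq, measProjSeq_mul_self,
    resultProb]

theorem trace_postState {r : Fin n → Fin (t + 1)} {ρ : QOp (l * (t + 1)) n}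
    (h : resultProb r ρ ≠ 0) : (postState r ρ).trace = 1 := by
  rw [postState, trace_smul, ← resultProb_eq_trace, smul_eq_mul, inv_mul_cancel₀ h]

theorem trace_conjTranspose_etaIso_postState {r : Fin n → Fin (t + 1)} {ρ : QOp (l * (t + 1)) n}
    (h : resultProb r ρ ≠ 0) : ((etaIso l r)ᴴ * postState r ρ * etaIso l r).trace = 1 := by
  rw [trace_mul_comm, ← Matrix.mul_assoc, ← measProjSeq_eq, ← trace_postState h, postState,
    Matrix.mul_smul, ← Matrix.mul_assoc, ← Matrix.mul_assoc, measProjSeq_mul_self]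

/-- The state of the code lies in the sector of the periodic sequence. -/
theorem postState_etaIso_conj {r s : Fin n → Fin (t + 1)} {κ : QOp l n} (hκ : κ.trace = 1)
    (h : resultProb r (etaIso l s * κ * (etaIso l s)ᴴ) ≠ 0) :
    r = s ∧ postState r (etaIso l s * κ * (etaIso l s)ᴴ) = etaIso l s * κ * (etaIso l s)ᴴ := by
  have hrs : r = s := by
    by_contra hne
    apply h
    rw [resultProb_eq_trace]
    convert trace_zero (Fin n → Fin (l * (t + 1))) ℂ
    ext x y
    rw [measProjSeq_conj_apply, etaIso_conj_apply]
    split_ifs with h₁ h₂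
    · exact absurd (h₁.1.symm.trans h₂.1) hne
    all_goals rfl
  subst hrs
  have hM : measProjSeq l r * (etaIso l r * κ * (etaIso l r)ᴴ) * (measProjSeq l r)ᴴ =
      etaIso l r * κ * (etaIso l r)ᴴ := by
    ext x y
    rw [measProjSeq_conj_apply, etaIso_conj_apply]
    split_ifs <;> rfl
  refine ⟨rfl, ?_⟩
  rw [postState, resultProb_eq_trace, hM, trace_mul_comm, ← Matrix.mul_assoc, etaIso_isometry,
    Matrix.one_mul, hκ, inv_one, one_smul]

theorem removeQudit_etaIso_conj (b : Fin (n + 1)) (s : Fin (n + 1) → Fin (t + 1))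
    (κ : QOp l (n + 1)) :
    removeQudit b (etaIso l s * κ * (etaIso l s)ᴴ) =
      etaIso l (s ∘ b.succAbove) * removeQudit b κ * (etaIso l (s ∘ b.succAbove))ᴴ := by
  have h : #({b} : Finset (Fin (n + 1)))ᶜ = n := by simp [card_compl]
  have hs : subword _ h s = s ∘ b.succAbove := by
    rw [← orderEmbOfFin_singleton_compl b h]; rfl
  rw [← deletion_singleton b h, deletion_etaIso_conj, deletion_singleton, hs]

theorem levelWord_comp {m : ℕ} (x : Fin n → Fin (l * (t + 1))) (f : Fin m → Fin n) :
    levelWord (x ∘ f) = levelWord x ∘ f := rfl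

/-- Measuring a state with one inserted qudit projects the inserted qudit only. -/
theorem postState_insertQudit {r : Fin (n + 1) → Fin (t + 1)} {s : Fin n → Fin (t + 1)}
    {κ : QOp l n} (hκ : κ.trace = 1) {a : Fin (n + 1)}
    {P : Matrix (Fin (l * (t + 1))) (Fin (l * (t + 1))) ℂ}
    (h : resultProb r (insertQudit a P (etaIso l s * κ * (etaIso l s)ᴴ)) ≠ 0) :
    r ∘ a.succAbove = s ∧ ∃ Q : Matrix (Fin (l * (t + 1))) (Fin (l * (t + 1))) ℂ, Q.trace = 1 ∧
      postState r (insertQudit a P (etaIso l s * κ * (etaIso l s)ᴴ)) =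
        insertQudit a Q (etaIso l s * κ * (etaIso l s)ᴴ) := by
  have hrs : r ∘ a.succAbove = s := by
    by_contra hne
    apply h
    rw [resultProb_eq_trace]
    convert trace_zero (Fin (n + 1) → Fin (l * (t + 1))) ℂ
    ext x y
    rw [measProjSeq_conj_apply, insertQudit, of_apply, etaIso_conj_apply]
    split_ifs with h₁ h₂
    · refine absurd ?_ hne
      rw [← h₁.1, ← h₂.1]; rfl
    · rw [mul_zero]; rfl
    · rfl
  refine ⟨hrs, ?_⟩
  have key : ∃ Q : Matrix (Fin (l * (t + 1))) (Fin (l * (t + 1))) ℂ,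
      postState r (insertQudit a P (etaIso l s * κ * (etaIso l s)ᴴ)) =
        insertQudit a Q (etaIso l s * κ * (etaIso l s)ᴴ) := by
    -- The inserted qudit is compressed to the range of `η_{r a}`; the normalisation of the whole
    -- state is put on this factor, and its trace is then `1` because `κ` has trace one.
    refine ⟨(resultProb r (insertQudit a P (etaIso l s * κ * (etaIso l s)ᴴ)))⁻¹ •
      Matrix.of fun p q => if (finProdFinEquiv.symm p).2 = r a ∧ (finProdFinEquiv.symm q).2 = r a
        then P p q else 0, ?_⟩
    rw [postState]
    ext x y
    rw [Matrix.smul_apply, measProjSeq_conj_apply]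
    simp only [insertQudit, of_apply, Matrix.smul_apply, etaIso_conj_apply, smul_eq_mul,
      mul_assoc]
    congr 1
    have hlev : ∀ x : Fin (n + 1) → Fin (l * (t + 1)),
        levelWord x = r ↔ (finProdFinEquiv.symm (x a)).2 = r a ∧ levelWord (x ∘ a.succAbove) = s := by
      intro x
      rw [← hrs, levelWord_comp]
      constructor
      · rintro rfl; exact ⟨rfl, rfl⟩
      · rintro ⟨h₁, h₂⟩
        funext k
        rcases Fin.eq_self_or_eq_succAbove a k with rfl | ⟨j, rfl⟩
        · exact h₁
        · exact congrFun h₂ j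
    simp only [hlev]
    split_ifs <;> first | rfl | (exfalso; tauto) | simp
  obtain ⟨Q, hQ⟩ := key
  refine ⟨Q, ?_, hQ⟩
  have := trace_postState h
  rwa [hQ, trace_insertQudit, trace_mul_comm, ← Matrix.mul_assoc, etaIso_isometry, Matrix.one_mul,
    hκ, mul_one] at this

/-- Undoing the maps `η` on a state whose qudit `a` has been replaced. -/
theorem conjTranspose_etaIso_conj_insertQudit (s : Fin (n + 1) → Fin (t + 1)) (κ : QOp l n)
    (a : Fin (n + 1)) (Q : Matrix (Fin (l * (t + 1))) (Fin (l * (t + 1))) ℂ) :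
    (etaIso l s)ᴴ * insertQudit a Q
      (etaIso l (s ∘ a.succAbove) * κ * (etaIso l (s ∘ a.succAbove))ᴴ) * etaIso l s =
      insertQudit a (Matrix.of fun p q => Q (eta (s a) p) (eta (s a) q)) κ := by
  ext z w
  rw [mul_etaIso_apply, conjTranspose_etaIso_mul_apply]
  simp only [insertQudit, of_apply, etaIso_conj_apply]
  have h : ∀ z : Fin (n + 1) → Fin l,
      etaWord s z ∘ a.succAbove = etaWord (s ∘ a.succAbove) (z ∘ a.succAbove) := fun _ => rfl
  rw [h, h, levelWord_etaWord, levelWord_etaWord, baseWord_etaWord, baseWord_etaWord,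
    if_pos ⟨rfl, rfl⟩]
  rfl

end Measurement

/-! ### From unitary errors to arbitrary replacement of one qudit. -/

section UnitaryErrors

variable {l u n : ℕ}

/-- Replacing the qudit `a` is a combination of operators acting on this qudit. -/
theorem insertQudit_removeQudit (a : Fin (n + 1)) (Q : Matrix (Fin l) (Fin l) ℂ)
    (κ : QOp l (n + 1)) :
    insertQudit a Q (removeQudit a κ) = ∑ p, ∑ q, ∑ s, Q p q •
      (localOp a (single p s 1) * κ * (localOp a (single q s 1))ᴴ) := by
  have hr : ∀ (X Y : Matrix (Fin l) (Fin l) ℂ) (x y : Fin (n + 1) → Fin l),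
      (localOp a X * κ * (localOp a Y)ᴴ) x y = ∑ s, ∑ s', X (x a) s * star (Y (y a) s') *
        κ (Function.update x a s) (Function.update y a s') := by
    intro X Y x y
    have h : localOp a X * κ * (localOp a Y)ᴴ = (localOp a Y * (localOp a X * κ)ᴴ)ᴴ := by
      rw [conjTranspose_mul, conjTranspose_conjTranspose]
    rw [h, conjTranspose_apply, localOp_mul_apply, star_sum, Finset.sum_comm]
    refine Finset.sum_congr rfl fun s' _ => ?_
    rw [star_mul', conjTranspose_apply, star_star, localOp_mul_apply, Finset.mul_sum]
    exact Finset.sum_congr rfl fun s _ => by ring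
  ext x y
  simp only [Matrix.sum_apply, Matrix.smul_apply, hr, insertQudit, removeQudit, of_apply]
  have hu : ∀ (s : Fin l) (x : Fin (n + 1) → Fin l),
      (a.insertNth s (x ∘ a.succAbove) : Fin (n + 1) → Fin l) = Function.update x a s :=
    fun s x => Fin.insertNth_removeNth a s x
  simp only [hu, single_apply, Finset.mul_sum]
  symm
  rw [Finset.sum_eq_single (x a), Finset.sum_eq_single (y a)]
  · refine Finset.sum_congr rfl fun s _ => ?_
    rw [Finset.sum_eq_single s, Finset.sum_eq_single s]
    · simp
    · intro s' _ hs'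
      simp [hs'.symm]
    · simp
    · intro s' _ hs'
      simp [hs'.symm]
    · simp
  · intro q _ hq
    simp [hq]
  · simp
  · intro p _ hp
    simp [hp]
  · simp

-- With the operator norm, matrices form a C*-algebra, and such an algebra is spanned by its
-- unitaries.
open scoped Matrix.Norms.L2Operator in
theorem span_unitaryGroup :
    Submodule.span ℂ (Matrix.unitaryGroup (Fin l) ℂ : Set (Matrix (Fin l) (Fin l) ℂ)) = ⊤ :=
  CStarAlgebra.span_unitary (Matrix (Fin l) (Fin l) ℂ)

theorem eq_ketbra_of_mem_span {μ : QVec l u} (hμ : IsUnitKet μ) {X : QOp l u}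
    (h : X ∈ Submodule.span ℂ {ketbra μ}) (hX : X.trace = 1) : X = ketbra μ := by
  obtain ⟨c, rfl⟩ := Submodule.mem_span_singleton.1 h
  rw [trace_smul, trace_ketbra hμ, smul_eq_mul, mul_one] at hX
  rw [hX, one_smul]

/-- A corrector of single unitary errors corrects an arbitrary replacement of one qudit. -/
theorem IsUnitaryErrorCorrector.apply_insertQudit {V : Encoder l u l (n + 1)}
    {Φ : QOp l (n + 1) →ₗ[ℂ] QOp l u} (hΦ : IsUnitaryErrorCorrector V Φ) {μ : QVec l u}
    (hμ : IsUnitKet μ) (a : Fin (n + 1)) (Q : Matrix (Fin l) (Fin l) ℂ)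
    (htr : (insertQudit a Q (removeQudit a (ketbra (V *ᵥ μ)))).trace = 1) :
    Φ (insertQudit a Q (removeQudit a (ketbra (V *ᵥ μ)))) = ketbra μ := by
  obtain ⟨hch, hU⟩ := hΦ
  refine eq_ketbra_of_mem_span hμ ?_ (by rw [hch.trace_apply, htr])
  obtain ⟨k, K, hK, hΦK⟩ := hch
  -- For a fixed Kraus operator, being scalar on `localOp a X * V` is linear in `X`, unlike the
  -- error map itself. The output is then a multiple of `ketbra μ`, and its trace fixes the factor.
  have hX : ∀ (X : Matrix (Fin l) (Fin l) ℂ) (c : Fin k),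
      K c * (localOp a X * V) ∈ Submodule.span ℂ {(1 : QOp l u)} := by
    intro X c
    have hXmem : X ∈ Submodule.span ℂ
        (Matrix.unitaryGroup (Fin l) ℂ : Set (Matrix (Fin l) (Fin l) ℂ)) := by
      rw [span_unitaryGroup]; trivial
    induction hXmem using Submodule.span_induction with
    | mem U hUmem =>
      refine kraus_mul_mem_span_one (fun μ hμ => ?_) c
      have h := hU a U hUmem μ hμ
      rw [hΦK] at h
      refine Eq.trans (Finset.sum_congr rfl fun c _ => ?_) h
      change K c * ketbra ((localOp a U * V) *ᵥ μ) * (K c)ᴴ = _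
      rw [ketbra_mulVec, ketbra_mulVec]
      simp only [conjTranspose_mul, Matrix.mul_assoc]
    | zero =>
      have h : localOp a (0 : Matrix (Fin l) (Fin l) ℂ) = 0 := map_zero (localOpLin a)
      rw [h, Matrix.zero_mul, Matrix.mul_zero]
      exact zero_mem _
    | add X Y _ _ hX hY =>
      have h : localOp a (X + Y) = localOp a X + localOp a Y := map_add (localOpLin a) X Y
      rw [h, Matrix.add_mul, Matrix.mul_add]
      exact add_mem hX hY
    | smul b X _ hX =>
      have h : localOp a (b • X) = b • localOp a X := map_smul (localOpLin a) b X
      rw [h, smul_mul, Matrix.mul_smul]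
      exact Submodule.smul_mem _ _ hX
  rw [insertQudit_removeQudit]
  simp only [map_sum, map_smul]
  refine Submodule.sum_mem _ fun p _ => Submodule.sum_mem _ fun q _ =>
    Submodule.sum_mem _ fun s _ => Submodule.smul_mem _ _ ?_
  rw [hΦK]
  refine Submodule.sum_mem _ fun c _ => ?_
  obtain ⟨b, hb⟩ := Submodule.mem_span_singleton.1 (hX (single p s 1) c)
  obtain ⟨b', hb'⟩ := Submodule.mem_span_singleton.1 (hX (single q s 1) c)
  have h : K c * (localOp a (single p s 1) * ketbra (V *ᵥ μ) * (localOp a (single q s 1))ᴴ) *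
      (K c)ᴴ = K c * (localOp a (single p s 1) * V) * ketbra μ *
        (K c * (localOp a (single q s 1) * V))ᴴ := by
    rw [ketbra_mulVec]
    simp only [conjTranspose_mul, Matrix.mul_assoc]
  rw [h, ← hb, ← hb', Submodule.mem_span_singleton]
  exact ⟨star b' * b, by simp [smul_smul]⟩

theorem subsingleton_of_isometry {V : Encoder l u l 0} (hV : Vᴴ * V = 1) :
    Subsingleton (Fin u → Fin l) := by
  refine ⟨fun x y => by_contra fun hxy => ?_⟩
  have h : ∀ x y, star (V default x) * V default y = (1 : QOp l u) x y := by
    intro x y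
    rw [← hV, mul_apply, Fintype.sum_unique, conjTranspose_apply]
  have hx := h x x
  have hy := h y y
  have hn := h x y
  rw [one_apply_eq] at hx hy
  rw [one_apply_ne hxy] at hn
  rcases mul_eq_zero.1 hn with h₀ | h₀
  · rw [h₀, zero_mul] at hx; exact zero_ne_one hx
  · rw [h₀, mul_zero] at hy; exact zero_ne_one hy

/-- A corrector of single unitary errors returns the message if there is no error. -/
theorem IsUnitaryErrorCorrector.apply_ketbra {V : Encoder l u l n} (hV : Vᴴ * V = 1)
    {Φ : QOp l n →ₗ[ℂ] QOp l u} (hΦ : IsUnitaryErrorCorrector V Φ) {μ : QVec l u}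
    (hμ : IsUnitKet μ) : Φ (ketbra (V *ᵥ μ)) = ketbra μ := by
  cases n with
  | zero =>
    -- Without qudits there is no index at which to apply the trivial error; but the isometry makes
    -- the message space one-dimensional, where the trace determines the operator.
    have hsub := subsingleton_of_isometry hV
    have htr : (Φ (ketbra (V *ᵥ μ))).trace = (ketbra μ).trace := by
      rw [hΦ.1.trace_apply, ketbra_mulVec, trace_mul_comm, ← Matrix.mul_assoc, hV, Matrix.one_mul]
    ext x y
    obtain rfl := Subsingleton.elim x y
    have hu : (univ : Finset (Fin u → Fin l)) = {x} :=
      eq_singleton_iff_unique_mem.2 ⟨mem_univ x, fun y _ => Subsingleton.elim y x⟩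
    simpa [trace, hu] using htr
  | succ n =>
    have h := hΦ.2 0 1 (one_mem _) μ hμ
    rwa [localOp_one, Matrix.one_mul, conjTranspose_one, Matrix.mul_one] at h

end UnitaryErrors

/-! ### Correctness of the decoder. -/

section Decoding

/-- The received length `m` is kept free: in the decoder it is computed from the candidate set, not
from the set `J` deleted from the codeword. -/
theorem IsDeletionCorrector.apply_deletion {l u d n t m : ℕ} {W : Encoder l u d n}
    {Δ : (m : ℕ) → QOp d m →ₗ[ℂ] QOp l u} (hΔ : IsDeletionCorrector t W Δ) {μ : QVec l u}
    (hμ : IsUnitKet μ) {J : Finset (Fin n)} (h : #Jᶜ = m) (hm : n ≤ m + t) :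
    Δ m (deletion J h (ketbra (W *ᵥ μ))) = ketbra μ := by
  obtain rfl : n - #J = m := by rw [← h, card_compl_eq_sub]
  exact hΔ.2 J (by have := card_le_univ J; rw [Fintype.card_fin] at this; omega) μ hμ

theorem card_toIndexSet_le (n : ℕ) (S : Finset ℕ) : #(toIndexSet n S) ≤ #S := by
  refine card_le_card_of_injOn (fun a => a.val + 1) (fun a ha => ?_) fun a _ b _ hab => ?_
  · simpa [toIndexSet] using ha
  · exact Fin.ext (by simpa using hab)

theorem decoder_of_ne {l u n t : ℕ} (Φ : QOp l n →ₗ[ℂ] QOp l u)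
    (Δ : (m : ℕ) → QOp (l * (t + 1)) m →ₗ[ℂ] QOp l u) (ρ : QOp (l * (t + 1)) n)
    {r : Fin n → Fin (t + 1)} (hr : r ≠ periodicSeq n t) {S₁ S₂ : Finset ℕ}
    (h₁ : subroutineOne (periodicSeq n t) r = some S₁)
    (h₂ : subroutineTwo (periodicSeq n t) r = some S₂) :
    decoder Φ Δ ρ r = some (Δ (n - #(toIndexSet n (S₁ ∪ S₂)))
      (deletion (toIndexSet n (S₁ ∪ S₂)) (card_compl_eq_sub _) (postState r ρ))) := by
  rw [decoder, if_neg hr, h₁, h₂]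
  rfl

/-- The decoder corrects one insertion followed by one deletion. -/
theorem decoder_correct {l u n t : ℕ} (ht : 2 ≤ t) {V : Encoder l u l n} (hV : Vᴴ * V = 1)
    {Φ : QOp l n →ₗ[ℂ] QOp l u} {Δ : (m : ℕ) → QOp (l * (t + 1)) m →ₗ[ℂ] QOp l u}
    (hΦ : IsUnitaryErrorCorrector V Φ) (hΔ : IsDeletionCorrector t (delEncoder t V) Δ)
    {μ : QVec l u} (hμ : IsUnitKet μ) {ρ : QOp (l * (t + 1)) n}
    (hρ : ρ ∈ indelSet 1 (ketbra (delEncoder t V *ᵥ μ))) {r : Fin n → Fin (t + 1)}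
    (hr : resultProb r ρ ≠ 0) :
    (r ≠ periodicSeq n t → ∃ S₁ S₂ : Finset ℕ,
      subroutineOne (periodicSeq n t) r = some S₁ ∧
      subroutineTwo (periodicSeq n t) r = some S₂ ∧ #(S₁ ∪ S₂) ≤ 2) ∧
    decoder Φ Δ ρ r = some (ketbra μ) := by
  have htr : (ketbra (V *ᵥ μ)).trace = 1 := by
    rw [ketbra_mulVec, trace_mul_comm, ← Matrix.mul_assoc, hV, Matrix.one_mul, trace_ketbra hμ]
  rw [ketbra_delEncoder] at hρ
  -- The case in which insertion and deletion cancel: the codeword passes the measurement unchanged.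
  have hcodeword : resultProb r (etaIso l (periodicSeq n t) * ketbra (V *ᵥ μ) *
        (etaIso l (periodicSeq n t))ᴴ) ≠ 0 →
      (r ≠ periodicSeq n t → ∃ S₁ S₂ : Finset ℕ,
        subroutineOne (periodicSeq n t) r = some S₁ ∧
        subroutineTwo (periodicSeq n t) r = some S₂ ∧ #(S₁ ∪ S₂) ≤ 2) ∧
      decoder Φ Δ (etaIso l (periodicSeq n t) * ketbra (V *ᵥ μ) *
        (etaIso l (periodicSeq n t))ᴴ) r = some (ketbra μ) := by
    intro hr
    obtain ⟨rfl, hpost⟩ := postState_etaIso_conj htr hr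
    refine ⟨fun h => absurd rfl h, ?_⟩
    rw [decoder, if_pos rfl, hpost]
    congr 1
    rw [← hΦ.apply_ketbra hV hμ]
    congr 1
    rw [Matrix.mul_assoc, Matrix.mul_assoc, Matrix.mul_assoc, etaIso_isometry, Matrix.mul_one,
      ← Matrix.mul_assoc, etaIso_isometry, Matrix.one_mul]
  cases n with
  | zero =>
    obtain rfl := eq_of_mem_indelSet_one_zero hρ
    exact hcodeword hr
  | succ n =>
    rcases eq_or_exists_of_mem_indelSet_one hρ with rfl | ⟨a, b, P, rfl⟩
    · exact hcodeword hr
    rw [removeQudit_etaIso_conj] at hr ⊢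
    obtain ⟨hrs, Q, hQ, hpost⟩ := postState_insertQudit (by rw [trace_removeQudit, htr]) hr
    by_cases hrm : r = periodicSeq (n + 1) t
    · refine ⟨fun h => absurd hrm h, ?_⟩
      have hab : a = b := eq_of_periodicSeq_comp_succAbove ht fun k => by
        rw [← hrm]; exact (congrFun hrs k).trans (by rw [hrm]; rfl)
      subst hab
      subst hrm
      rw [decoder, if_pos rfl, hpost, conjTranspose_etaIso_conj_insertQudit]
      congr 1
      refine hΦ.apply_insertQudit hμ a _ ?_
      rw [← conjTranspose_etaIso_conj_insertQudit, ← hpost]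
      exact trace_conjTranspose_etaIso_postState hr
    · obtain ⟨p, q, hp, hq, hapq⟩ := subroutines_of_comp_succAbove ht (congrFun hrs) hrm
      have hcard : #(({p} : Finset ℕ) ∪ {q}) ≤ 2 := card_union_le _ _
      refine ⟨fun _ => ⟨_, _, hp, hq, hcard⟩, ?_⟩
      rw [decoder_of_ne Φ Δ _ hrm hp hq]
      congr 1
      have haS : a ∈ toIndexSet (n + 1) ({p} ∪ {q}) := by
        simpa [toIndexSet] using hapq
      have hS := card_toIndexSet_le (n + 1) ({p} ∪ {q})
      rw [hpost, ← removeQudit_etaIso_conj, ← ketbra_delEncoder]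
      obtain ⟨J, h', hJ⟩ := deletion_insertQudit (b := b) hQ
        (ketbra (delEncoder t V *ᵥ μ)) (card_compl_eq_sub (toIndexSet (n + 1) ({p} ∪ {q}))) haS
      rw [hJ]
      -- The candidate set contains `a` and has at most two elements, so what remains is the
      -- codeword with at most `2 ≤ t` qudits deleted.
      exact hΔ.apply_deletion hμ h' (by omega)

end Decoding

end IndelQuantum

theorem mainTheorem1 (l u n t : ℕ) (hl : 1 ≤ l) (ht : 2 ≤ t)
    (V : IndelQuantum.Encoder l u l n) (hV : V.conjTranspose * V = 1)
    (hC : IndelQuantum.IsErasureCorrecting t V) :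
    (∃ Φ : IndelQuantum.QOp l n →ₗ[ℂ] IndelQuantum.QOp l u,
      IndelQuantum.IsUnitaryErrorCorrector V Φ) ∧
    (∃ Δ : (m : ℕ) → IndelQuantum.QOp (l * (t + 1)) m →ₗ[ℂ] IndelQuantum.QOp l u,
      IndelQuantum.IsDeletionCorrector t (IndelQuantum.delEncoder t V) Δ) ∧
    ∀ (Φ : IndelQuantum.QOp l n →ₗ[ℂ] IndelQuantum.QOp l u)
      (Δ : (m : ℕ) → IndelQuantum.QOp (l * (t + 1)) m →ₗ[ℂ] IndelQuantum.QOp l u),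
      IndelQuantum.IsUnitaryErrorCorrector V Φ →
      IndelQuantum.IsDeletionCorrector t (IndelQuantum.delEncoder t V) Δ →
      ∀ (μ : IndelQuantum.QVec l u), IndelQuantum.IsUnitKet μ →
      ∀ ρ ∈ IndelQuantum.indelSet 1
        (IndelQuantum.ketbra ((IndelQuantum.delEncoder t V).mulVec μ)),
      ∀ r : Fin n → Fin (t + 1), IndelQuantum.resultProb r ρ ≠ 0 →
        (r ≠ IndelQuantum.periodicSeq n t →
          ∃ S₁ S₂ : Finset ℕ,
            IndelQuantum.subroutineOne (IndelQuantum.periodicSeq n t) r = some S₁ ∧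
            IndelQuantum.subroutineTwo (IndelQuantum.periodicSeq n t) r = some S₂ ∧
            (S₁ ∪ S₂).card ≤ 2) ∧
        IndelQuantum.decoder Φ Δ ρ r = some (IndelQuantum.ketbra μ) :=
  ⟨IndelQuantum.exists_unitaryErrorCorrector hl ht hV hC,
    IndelQuantum.exists_deletionCorrector hl hC,
    fun _ _ hΦ hΔ _ hμ _ hρ _ hr => IndelQuantum.decoder_correct ht hV hΦ hΔ hμ hρ hr⟩
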